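/- Let $\mathbf{GLP}$ be the propositional modal logic with modalities $[0],[1],[2],\dots$ over countably many propositional variables, where $\langle n\rangle\varphi:=\neg[n]\neg\varphi$, whose axioms are all Boolean tautologies, $[n](\varphi\to\psi)\to([n]\varphi\to[n]\psi)$, $[n]([n]\varphi\to\varphi)\to[n]\varphi$, and, for $m<n$, $[m]\varphi\to[n]\varphi$ and $\langle m\rangle\varphi\to[n]\langle m\rangle\varphi$, and whose rules are modus ponens and necessitation $\varphi/[n]\varphi$. For a topology $\tau$ on $X$ let $d_\tau(A)$ denote the set of limit points of $A\subseteq X$. The logic $\mathrm{Log}(X)$ of a polytopological space $X=(X,\tau_0,\tau_1,\dots)$ is the set of formulas $\varphi$ with $v(\varphi)=X$ for all valuations $v$ of the variables by subsets of $X$, where $v$ commutes with the Boolean connectives and $v(\langle n\rangle\varphi)=d_{\tau_n}(v(\varphi))$, that is, $v([n]\varphi)=X\setminus d_{\tau_n}(X\setminus v(\varphi))$. A topology $\tau$ on $X$ is scattered if every nonempty subspace has an isolated point. Then let $d^0X=X$, $d^{\alpha+1}X=d_\tau(d^\alpha X)$, $d^\lambda X=\bigcap_{\alpha<\lambda}d^\alpha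 X$ for limit $\lambda$, and let $\rho_\tau(x)=\min\{\alpha: x\notin d^{\alpha+1}X\}$. A topology $\sigma\supseteq\tau$ is an $\ell$-extension of $\tau$ if $\rho_\sigma=\rho_\tau$ and, for every $U\in\sigma$ and every $x\in U$ such that $\rho_\tau(x)$ is not a limit ordinal, there is $V\in\tau$ with $x\in V\subseteq U$. A scattered topology is $\ell$-maximal if it has no proper $\ell$-extension. Let $\tau^+$ be the topology generated by $\tau$ and all sets $d_\tau(A)$, $A\subseteq X$. A polytopological space $(X,\tau_0,\tau_1,\dots)$ is an lme-space based on a scattered topology $\tau$ if $\tau_0$ is an $\ell$-maximal $\ell$-extension of $\tau$ and, for each $n$, $\tau_{n+1}$ is an $\ell$-maximal $\ell$-extension of $\tau_n^+$. It is an ordinal lme-space if $X$ is an ordinal and $\tau$ is its order topology. Theorem. There is an ordinal lme-space $X=(\varepsilon_0,\tau_0,\tau_1,\dots)$, with underlying set the ordinal $\varepsilon_0$ (the least ordinal $\alpha$ with $\omega^\alpha=\alpha$), such that $\mathrm{Log}(X)=\mathbf{GLP}$. -/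

import Mathlib

open scoped Topology

/-! ### The logic GLP -/

/-- Modal formulas over countably many propositional variables, with modalities `[n]`, `n : ℕ`.
The other connectives are the usual Boolean abbreviations. -/
inductive ModalFormula : Type
  | var : ℕ → ModalFormula
  | bot : ModalFormula
  | imp : ModalFormula → ModalFormula → ModalFormula
  | box : ℕ → ModalFormula → ModalFormula

namespace ModalFormula

/-- Negation `¬φ`. -/
def neg (φ : ModalFormula) : ModalFormula := imp φ bot

/-- `⟨n⟩φ := ¬[n]¬φ`. -/
def dia (n : ℕ) (φ : ModalFormula) : ModalFormula := neg (box n (neg φ))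

/-- `φ` is (a substitution instance of) a Boolean tautology: it is true under every assignment of
truth values to formulas that respects the Boolean connectives (variables and boxed formulas are
treated as atoms). -/
def IsTautology (φ : ModalFormula) : Prop :=
  ∀ e : ModalFormula → Prop, ¬ e bot → (∀ ψ χ, e (imp ψ χ) ↔ (e ψ → e χ)) → e φ

end ModalFormula

open ModalFormula in
/-- Provability in Japaridze's logic GLP. -/
inductive GLPProvable : ModalFormula → Prop
  | taut {φ : ModalFormula} : IsTautology φ → GLPProvable φ
  | distr (n : ℕ) (φ ψ : ModalFormula) :
      GLPProvable (imp (box n (imp φ ψ)) (imp (box n φ) (box n ψ)))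
  | loeb (n : ℕ) (φ : ModalFormula) :
      GLPProvable (imp (box n (imp (box n φ) φ)) (box n φ))
  | mono {m n : ℕ} (hmn : m < n) (φ : ModalFormula) :
      GLPProvable (imp (box m φ) (box n φ))
  | negIntro {m n : ℕ} (hmn : m < n) (φ : ModalFormula) :
      GLPProvable (imp (dia m φ) (box n (dia m φ)))
  | mp {φ ψ : ModalFormula} : GLPProvable φ → GLPProvable (imp φ ψ) → GLPProvable ψ
  | nec (n : ℕ) {φ : ModalFormula} : GLPProvable φ → GLPProvable (box n φ)

/-- The set of theorems of GLP. -/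
def GLP : Set ModalFormula := {φ | GLPProvable φ}

/-! ### Neighborhood and topological semantics -/

/-- The value of a formula in the neighborhood frame `(X, δ 0, δ 1, …)` under the valuation `v` of
the variables; `⟨n⟩` is interpreted by `δ n` and `[n]` by the dual operator. -/
def ModalFormula.value {X : Type*} (δ : ℕ → Set X → Set X) (v : ℕ → Set X) :
    ModalFormula → Set X
  | .var p => v p
  | .bot => ∅
  | .imp φ ψ => (φ.value δ v)ᶜ ∪ ψ.value δ v
  | .box n φ => (δ n (φ.value δ v)ᶜ)ᶜ

/-- The logic of a neighborhood frame: all formulas valid in it. -/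
def frameLog {X : Type*} (δ : ℕ → Set X → Set X) : Set ModalFormula :=
  {φ | ∀ v : ℕ → Set X, φ.value δ v = Set.univ}

/-- The derived set operator `d_τ` of the topology `τ`. -/
def derivOp {X : Type*} (τ : TopologicalSpace X) (A : Set X) : Set X :=
  @derivedSet X τ A

/-- The logic `Log(X)` of a polytopological space `(X, τ 0, τ 1, …)`. -/
def topLog {X : Type*} (τ : ℕ → TopologicalSpace X) : Set ModalFormula :=
  frameLog fun n => derivOp (τ n)

/-! ### Scattered spaces, ranks, ℓ-maximal topologies -/

/-- `(X, τ)` is scattered: every nonempty subspace has an isolated point. -/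
def IsScattered {X : Type*} (τ : TopologicalSpace X) : Prop :=
  ∀ A : Set X, A.Nonempty → ∃ x ∈ A, ∃ U : Set X, IsOpen[τ] U ∧ U ∩ A = {x}

/-- The `α`-th Cantor–Bendixson derivative `d^α X` of the whole space. (All members of the sequence
are closed, so the relative derived sets iterated by Mathlib are the derived sets.) -/
noncomputable def cbDeriv {X : Type*} (τ : TopologicalSpace X) (α : Ordinal) : Set X :=
  @CantorBendixson.iteratedDerivedSet X τ Set.univ α

/-- The Cantor–Bendixson rank function `ρ_τ(x) = min {α | x ∉ d^(α+1) X}` (used for scattered `τ`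
only, where the minimum exists). -/
noncomputable def cbRank {X : Type*} (τ : TopologicalSpace X) (x : X) : Ordinal :=
  sInf {α | x ∉ cbDeriv τ (α + 1)}

/-- `σ` is an ℓ-extension of `τ`: it is finer, has the same rank function, and the identity
`(X, τ) → (X, σ)` is continuous at all points of non-limit rank. (In Mathlib's order on topologies,
`σ ≤ τ` says that every `τ`-open set is `σ`-open; `0` is not an `Order.IsSuccLimit`.) -/
structure IsLExtension {X : Type*} (τ σ : TopologicalSpace X) : Prop where
  le : σ ≤ τ
  rank_eq : ∀ x, cbRank σ x = cbRank τ x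
  nonlimit : ∀ U : Set X, IsOpen[σ] U → ∀ x ∈ U, ¬ Order.IsSuccLimit (cbRank τ x) →
    ∃ V : Set X, IsOpen[τ] V ∧ x ∈ V ∧ V ⊆ U

/-- `τ` is ℓ-maximal: it has no proper ℓ-extension. -/
def IsLMaximal {X : Type*} (τ : TopologicalSpace X) : Prop :=
  ∀ σ : TopologicalSpace X, IsLExtension τ σ → σ = τ

/-- The next topology `τ⁺`, generated by `τ` and all the derived sets `d_τ(A)`. -/
abbrev plusTopology {X : Type*} (τ : TopologicalSpace X) : TopologicalSpace X :=
  TopologicalSpace.generateFrom ({U | IsOpen[τ] U} ∪ Set.range (derivOp τ))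

/-- `(X, τ 0, τ 1, …)` is an lme-space based on the scattered topology `τb`. -/
structure IsLmeSpace {X : Type*} (τb : TopologicalSpace X) (τ : ℕ → TopologicalSpace X) :
    Prop where
  scattered : IsScattered τb
  zero_ext : IsLExtension τb (τ 0)
  zero_max : IsLMaximal (τ 0)
  succ_ext : ∀ n, IsLExtension (plusTopology (τ n)) (τ (n + 1))
  succ_max : ∀ n, IsLMaximal (τ (n + 1))

/-- An ordinal lme-space with underlying ordinal `o`: an lme-space based on the order topology
of `o`. Here `o.ToType` is the well-ordered set of all ordinals below `o`. -/
def IsOrdinalLmeSpace (o : Ordinal) (τ : ℕ → TopologicalSpace o.ToType) : Prop :=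
  IsLmeSpace (Preorder.topology o.ToType) τ

/-! Zorn's lemma gives every scattered topology an ℓ-maximal ℓ-extension, so lme-spaces over the
order topology of `ε₀` exist. In fact every one of them has logic GLP
(`IsOrdinalLmeSpace.topLog_eq`).

The topological input: for ℓ-maximal τ the rank function, as a map from τ⁺ to the ordinals with the
interval topology, is continuous, pointwise discrete and open onto left neighborhoods
(`IsLMaximal.isOrdinalDMap_plusTopology`). Any such map `r` makes `endLog ∘ r` the rank function of
its domain. Hence level `n` of the space is controlled by the `n`-fold end-logarithm of the position
(`IsLmeSpace.rankTower`).

Soundness: Löb's axiom is induction on rank; the mixed axioms hold because each topology refines the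
earlier ones and makes their derived sets open.

Completeness: a maximal consistent world omits the unprovable formula. Only finitely many boxed
formulas and the modalities below some `N` matter. It suffices to label an interval `(0, l]`, `l <
ε₀`, by worlds, with the given world at `l`, so that `[m]ψ` lies in a label iff `ψ` lies in all
labels nearby (`mem_value_iff_mem_label`). Such labellings are built by downward induction on the
modality. In the step (`Realizable.of_succ`), `h` labels an interval `(0, k]` by `n`-successors of
`w` refuting the false `[n]ψ`, and `g` on `(0, l]` handles `w` for the modalities above `n`. With `a
= log ω k`, copies of `h` fill consecutive blocks of length `k`, and the remaining points, of
end-logarithm above `a`, get the label `g (endLog ξ - a)`. The modalities above `n` then see `g`,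
while blocks accumulate at the remaining points and refute what `[n]` must refute. The new length `ω
^ (a + l)` is still below `ε₀`. -/

namespace Ordinal

/-! ### End-logarithms and division of ordinals into blocks. -/

/-- The end-logarithm: `endLog α` is the exponent of the last term of the Cantor normal form
of `α` in base `ω`, and `endLog 0 = 0`. -/
noncomputable def endLog (α : Ordinal) : Ordinal :=
  sInf {β | ∃ δ, α = δ + ω ^ β}

theorem exists_eq_add_omega0_opow {α : Ordinal} (hα : α ≠ 0) : ∃ δ β : Ordinal, α = δ + ω ^ β := by
  induction α using WellFoundedLT.induction with
  | ind α ih =>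
    by_cases hp : IsPrincipal (· + ·) α
    · rcases isPrincipal_add_iff_zero_or_omega0_opow.1 hp with h | ⟨β, hβ⟩
      · exact absurd h hα
      · exact ⟨0, β, by simpa using hβ.symm⟩
    · obtain ⟨b, hb, c, hc, h⟩ := exists_lt_add_of_not_isPrincipal_add hp
      have hc0 : c ≠ 0 := by
        rintro rfl
        simp only [add_zero] at h
        exact hb.ne h
      obtain ⟨δ, β, rfl⟩ := ih c hc hc0
      exact ⟨b + δ, β, by rw [← h, add_assoc]⟩

/-- `ω ^ β` absorbs every smaller summand on its left, so cancelling `η` leaves equal powers. This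
makes the last exponent of the normal form unique. -/
theorem omega0_opow_eq_of_add_eq {η β β' : Ordinal} (h : ω ^ β = η + ω ^ β') : β = β' := by
  have hη : η ≤ ω ^ β := h ▸ le_self_add
  rcases hη.lt_or_eq with hlt | heq
  · have h2 := (isPrincipal_add_omega0_opow β).add_eq_right hlt
    have h3 : η + ω ^ β = η + ω ^ β' := by rw [h2, h]
    have h4 : ω ^ β = ω ^ β' := by simpa using h3
    exact (opow_right_inj one_lt_omega0).1 h4
  · rw [heq] at h
    have h0 : ω ^ β' = 0 := by simpa using h.symm
    exact absurd h0 (opow_pos _ omega0_pos).ne'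

theorem endLog_add_omega0_opow (δ β : Ordinal) : endLog (δ + ω ^ β) = β := by
  have hs : {β' | ∃ δ', δ + ω ^ β = δ' + ω ^ β'} = {β} := by
    ext β'
    simp only [Set.mem_ofPred_eq, Set.mem_singleton_iff]
    constructor
    · rintro ⟨δ', h⟩
      rcases le_total δ δ' with hle | hle
      · obtain ⟨η, rfl⟩ := exists_add_of_le hle
        rw [add_assoc] at h
        exact (omega0_opow_eq_of_add_eq (by simpa using h)).symm
      · obtain ⟨η, rfl⟩ := exists_add_of_le hle
        rw [add_assoc] at h
        exact omega0_opow_eq_of_add_eq (by simpa using h.symm)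
    · rintro rfl
      exact ⟨δ, rfl⟩
  rw [endLog, hs, csInf_singleton]

theorem endLog_zero : endLog 0 = 0 := by
  have hs : {β : Ordinal | ∃ δ, 0 = δ + ω ^ β} = ∅ := by
    ext β
    simp only [Set.mem_ofPred_eq, Set.mem_empty_iff_false, iff_false]
    rintro ⟨δ, hδ⟩
    exact (opow_pos β omega0_pos).ne' (Ordinal.add_eq_zero_iff.1 hδ.symm).2
  rw [endLog, hs, Ordinal.sInf_empty]

theorem endLog_omega0_opow (β : Ordinal) : endLog (ω ^ β) = β := by
  simpa using endLog_add_omega0_opow 0 β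

theorem exists_eq_add_opow_endLog {α : Ordinal} (hα : α ≠ 0) : ∃ δ, α = δ + ω ^ endLog α := by
  obtain ⟨δ, β, rfl⟩ := exists_eq_add_omega0_opow hα
  exact ⟨δ, by rw [endLog_add_omega0_opow]⟩

theorem endLog_add (γ : Ordinal) {ξ : Ordinal} (hξ : ξ ≠ 0) : endLog (γ + ξ) = endLog ξ := by
  obtain ⟨δ, β, rfl⟩ := exists_eq_add_omega0_opow hξ
  rw [← add_assoc, endLog_add_omega0_opow, endLog_add_omega0_opow]

theorem omega0_opow_endLog_le {ξ : Ordinal} (hξ : ξ ≠ 0) : ω ^ endLog ξ ≤ ξ := by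
  obtain ⟨δ, β, rfl⟩ := exists_eq_add_omega0_opow hξ
  rw [endLog_add_omega0_opow]
  exact le_add_self

theorem endLog_lt {ξ β : Ordinal} (hξ : ξ ≠ 0) (h : ξ < ω ^ β) : endLog ξ < β :=
  (opow_lt_opow_iff_right one_lt_omega0).1 ((omega0_opow_endLog_le hξ).trans_lt h)

theorem endLog_le_log {ξ κ : Ordinal} (hξ : ξ ≠ 0) (h : ξ ≤ κ) : endLog ξ ≤ log ω κ := by
  refine (opow_le_iff_le_log one_lt_omega0 ?_).1 ((omega0_opow_endLog_le hξ).trans h)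
  rintro rfl
  exact hξ (nonpos_iff_eq_zero.1 h)

theorem endLog_mul_add_le {κ q η : Ordinal} (hη : 0 < η) (h : η ≤ κ) :
    endLog (κ * q + η) ≤ log ω κ := by
  rw [endLog_add _ hη.ne']
  exact endLog_le_log hη.ne' h

/-- Writing `q = ω * c`, the identity `κ * ω = ω ^ (log ω κ + 1)` turns `κ * q` into a multiple `ω ^
(log ω κ + 1) * c`. The end-logarithm thus separates limit multiples of `κ` from the points inside
blocks. -/
theorem log_lt_endLog_mul {κ q : Ordinal} (hκ : κ ≠ 0) (hq : Order.IsSuccLimit q) :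
    log ω κ < endLog (κ * q) := by
  obtain ⟨c, rfl⟩ := isSuccPrelimit_iff_omega0_dvd.1 hq.isSuccPrelimit
  have hq0 := (isSuccLimit_iff.1 hq).1
  have hc : c ≠ 0 := by
    rintro rfl
    simp at hq0
  obtain ⟨δ, β, rfl⟩ := exists_eq_add_omega0_opow hc
  rw [mul_add, mul_add, endLog_add]
  · rw [← mul_assoc, mul_eq_opow_log_succ hκ isPrincipal_mul_omega0
      (by exact_mod_cast natCast_lt_omega0 2), ← opow_add, endLog_omega0_opow]
    exact (Order.lt_succ _).trans_le le_self_add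
  · have := (opow_pos β omega0_pos).ne'
    simp [hκ, this]

/-- Every positive ordinal either lies in a block `(κq, κq + κ]` or is `κq` for a limit `q`. -/
theorem exists_mul_add_or_mul_limit {κ ξ : Ordinal} (hκ : κ ≠ 0) (hξ : ξ ≠ 0) :
    (∃ q η, 0 < η ∧ η ≤ κ ∧ ξ = κ * q + η) ∨ ∃ q, Order.IsSuccLimit q ∧ ξ = κ * q := by
  by_cases hm : ξ % κ = 0
  · obtain ⟨q, rfl⟩ := dvd_of_mod_eq_zero hm
    rcases zero_or_succ_or_isSuccLimit q with rfl | ⟨p, rfl⟩ | hq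
    · simp at hξ
    · exact .inl ⟨p, κ, pos_iff_ne_zero.2 hκ, le_rfl, mul_succ _ _⟩
    · exact .inr ⟨q, hq, rfl⟩
  · exact .inl ⟨ξ / κ, ξ % κ, pos_iff_ne_zero.2 hm, (mod_lt _ hκ).le, (div_add_mod _ _).symm⟩

theorem exists_mul_add_of_endLog_le {κ ξ : Ordinal} (hκ : κ ≠ 0) (hξ : ξ ≠ 0)
    (h : endLog ξ ≤ log ω κ) : ∃ q η, 0 < η ∧ η ≤ κ ∧ ξ = κ * q + η := by
  rcases exists_mul_add_or_mul_limit hκ hξ with h' | ⟨q, hq, rfl⟩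
  · exact h'
  · exact absurd h (log_lt_endLog_mul hκ hq).not_ge

theorem exists_mul_limit_of_log_lt_endLog {κ ξ : Ordinal} (hκ : κ ≠ 0) (hξ : ξ ≠ 0)
    (h : log ω κ < endLog ξ) : ∃ q, Order.IsSuccLimit q ∧ ξ = κ * q := by
  rcases exists_mul_add_or_mul_limit hκ hξ with ⟨q, η, h0, h1, rfl⟩ | h'
  · exact absurd h (endLog_mul_add_le h0 h1).not_gt
  · exact h'

open Classical in
/-- The position in `(0, κ]` of `ξ` inside its block `(κq, κq + κ]`. -/
noncomputable def blockPos (κ ξ : Ordinal) : Ordinal :=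
  if ξ % κ = 0 then κ else ξ % κ

theorem blockPos_mul_add {κ q η : Ordinal} (h0 : 0 < η) (h : η ≤ κ) :
    blockPos κ (κ * q + η) = η := by
  rcases h.lt_or_eq with hlt | rfl
  · rw [blockPos, mul_add_mod_self, mod_eq_of_lt hlt, if_neg h0.ne']
  · rw [blockPos, mul_add_mod_self, mod_self, if_pos rfl]

theorem omega0_opow_lt_epsilon_zero {α : Ordinal} (h : α < ε₀) : ω ^ α < ε₀ := by
  have := (opow_lt_opow_iff_right one_lt_omega0).2 h
  rwa [omega0_opow_epsilon] at this

theorem add_lt_epsilon_zero {α β : Ordinal} (hα : α < ε₀) (hβ : β < ε₀) :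
    α + β < ε₀ := by
  have h := isPrincipal_add_omega0_opow (ε₀)
  rw [omega0_opow_epsilon] at h
  exact h hα hβ

end Ordinal

universe u

/-! ### Ranks, ℓ-extensions and ℓ-maximality. -/

section ScatteredTopology

open Order

variable {X : Type u} {τ σ : TopologicalSpace X} {ρ : X → Ordinal.{u}}

theorem isOpen_of_forall_exists {U : Set X}
    (h : ∀ x ∈ U, ∃ V, IsOpen[τ] V ∧ x ∈ V ∧ V ⊆ U) : IsOpen[τ] U := by
  let _ := τ
  rw [isOpen_iff_forall_mem_open]
  intro x hx
  obtain ⟨V, hV, hxV, hVU⟩ := h x hx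
  exact ⟨V, hVU, hV, hxV⟩

theorem mem_derivOp_iff {A : Set X} {x : X} :
    x ∈ derivOp τ A ↔ ∀ U, IsOpen[τ] U → x ∈ U → ∃ y ∈ U, y ∈ A ∧ y ≠ x := by
  let _ := τ
  change AccPt x (Filter.principal A) ↔ _
  rw [accPt_iff_nhds]
  constructor
  · intro h U hU hx
    obtain ⟨y, ⟨hyU, hyA⟩, hne⟩ := h U (hU.mem_nhds hx)
    exact ⟨y, hyU, hyA, hne⟩
  · intro h U hU
    obtain ⟨V, hVU, hV, hxV⟩ := mem_nhds_iff.1 hU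
    obtain ⟨y, hyV, hyA, hne⟩ := h V hV hxV
    exact ⟨y, ⟨hVU hyV, hyA⟩, hne⟩

theorem mem_cbDeriv_add_one {α : Ordinal.{u}} {x : X} :
    x ∈ cbDeriv τ (α + 1) ↔ x ∈ derivOp τ (cbDeriv τ α) := by
  let _ := τ
  have hc : IsClosed (cbDeriv τ α) :=
    CantorBendixson.isClosed_iteratedDerivedSet isClosed_univ α
  have h : cbDeriv τ (α + 1) = relDerivedSet (cbDeriv τ α) :=
    CantorBendixson.iteratedDerivedSet_succ
  rw [h, hc.relDerivedSet_eq]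
  rfl

/-- `ρ` is the Cantor–Bendixson rank function of `τ`, in terms of neighborhoods: near `x`
the values at other points are smaller than `ρ x`, and they are cofinal in it. -/
structure IsRank (τ : TopologicalSpace X) (ρ : X → Ordinal.{u}) : Prop where
  lower : ∀ x, ∃ U, IsOpen[τ] U ∧ x ∈ U ∧ ∀ y ∈ U, y ≠ x → ρ y < ρ x
  cofinal : ∀ x U, IsOpen[τ] U → x ∈ U → ∀ α < ρ x, ∃ y ∈ U, α ≤ ρ y ∧ ρ y < ρ x

namespace IsRank

theorem isOpen_lt (h : IsRank τ ρ) (β : Ordinal.{u}) : IsOpen[τ] {y | ρ y < β} := by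
  refine isOpen_of_forall_exists fun x hx => ?_
  obtain ⟨U, hU, hxU, hy⟩ := h.lower x
  refine ⟨U, hU, hxU, fun y hyU => ?_⟩
  by_cases hne : y = x
  · exact hne ▸ hx
  · exact (hy y hyU hne).trans hx

theorem exists_isOpen_subset (h : IsRank τ ρ) {x : X} {U : Set X} (hU : IsOpen[τ] U)
    (hx : x ∈ U) : ∃ V, IsOpen[τ] V ∧ x ∈ V ∧ V ⊆ U ∧ ∀ y ∈ V, y ≠ x → ρ y < ρ x := by
  let _ := τ
  obtain ⟨V, hV, hxV, hy⟩ := h.lower x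
  exact ⟨U ∩ V, IsOpen.inter hU hV, ⟨hx, hxV⟩, Set.inter_subset_left, fun y hyV => hy y hyV.2⟩

/-- A point of `U` of least rank at least `α` has rank exactly `α`, since otherwise `cofinal` gives
a smaller one. -/
theorem exists_rank_eq (h : IsRank τ ρ) {x : X} {U : Set X} (hU : IsOpen[τ] U) (hx : x ∈ U)
    {α : Ordinal.{u}} (hα : α ≤ ρ x) : ∃ y ∈ U, ρ y = α := by
  obtain ⟨y, ⟨hyU, hαy⟩, hmin⟩ := (InvImage.wf ρ (wellFounded_lt (α := Ordinal.{u}))).has_min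
    {y | y ∈ U ∧ α ≤ ρ y} ⟨x, hx, hα⟩
  refine ⟨y, hyU, ?_⟩
  by_contra hne
  obtain ⟨z, hzU, hαz, hzy⟩ := h.cofinal y U hU hyU α (lt_of_le_of_ne hαy (Ne.symm hne))
  exact hmin z ⟨hzU, hαz⟩ hzy

theorem cbDeriv_eq (h : IsRank τ ρ) (α : Ordinal.{u}) : cbDeriv τ α = {x | α ≤ ρ x} := by
  let _ := τ
  induction α using Ordinal.limitRecOn with
  | zero =>
    have : cbDeriv τ 0 = Set.univ := CantorBendixson.iteratedDerivedSet_zero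
    rw [this]
    ext x
    simp
  | add_one α ih =>
    ext x
    rw [mem_cbDeriv_add_one, ih, mem_derivOp_iff]
    constructor
    · intro hx
      obtain ⟨U, hU, hxU, hlt⟩ := h.lower x
      obtain ⟨y, hyU, hαy, hne⟩ := hx U hU hxU
      exact add_one_le_iff.2 (lt_of_le_of_lt hαy (hlt y hyU hne))
    · intro hx U hU hxU
      obtain ⟨y, hyU, hαy, hyx⟩ := h.cofinal x U hU hxU α (add_one_le_iff.1 hx)
      exact ⟨y, hyU, hαy, fun e => (e ▸ hyx).false⟩
  | limit α hα ih =>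
    have : cbDeriv τ α = ⋂ b : Set.Iio α, cbDeriv τ b :=
      CantorBendixson.iteratedDerivedSet_limit hα
    rw [this]
    ext x
    simp only [Set.mem_iInter, Subtype.forall, Set.mem_Iio]
    constructor
    · intro hx
      refine (hα.le_iff_forall_le).2 fun b hb => ?_
      have := hx b hb
      rwa [ih b hb] at this
    · intro hx b hb
      rw [ih b hb]
      exact hb.le.trans hx

theorem cbRank_eq (h : IsRank τ ρ) (x : X) : cbRank τ x = ρ x := by
  have : {α | x ∉ cbDeriv τ (α + 1)} = Set.Ici (ρ x) := by
    ext α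
    rw [Set.mem_ofPred_eq, h.cbDeriv_eq, Set.mem_Ici, Set.mem_ofPred_eq, add_one_le_iff, not_lt]
  rw [cbRank, this, csInf_Ici]

theorem isScattered (h : IsRank τ ρ) : IsScattered τ := by
  intro A hA
  obtain ⟨x, hxA, hmin⟩ :=
    (InvImage.wf ρ (wellFounded_lt (α := Ordinal.{u}))).has_min A hA
  obtain ⟨U, hU, hxU, hlt⟩ := h.lower x
  refine ⟨x, hxA, U, hU, ?_⟩
  ext y
  constructor
  · rintro ⟨hyU, hyA⟩
    by_contra hne
    exact hmin y hyA (hlt y hyU hne)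
  · rintro rfl
    exact ⟨hxU, hxA⟩

end IsRank

/-- The derivatives stabilize, and a nonempty stable value would have no isolated point. -/
theorem IsScattered.exists_notMem_cbDeriv (h : IsScattered τ) (x : X) :
    ∃ α : Ordinal.{u}, x ∉ cbDeriv τ (α + 1) := by
  let _ := τ
  obtain ⟨α, hα⟩ := CantorBendixson.iteratedDerivedSet_mem_fixedPoints (Set.univ : Set X)
  refine ⟨α, fun hx => ?_⟩
  have hfix : cbDeriv τ (α + 1) = cbDeriv τ α := by
    have h1 : cbDeriv τ (α + 1) = relDerivedSet (cbDeriv τ α) :=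
      CantorBendixson.iteratedDerivedSet_succ
    rw [h1]
    exact hα
  obtain ⟨y, hy, U, hU, hUy⟩ := h (cbDeriv τ α) ⟨x, hfix ▸ hx⟩
  rw [← hfix, mem_cbDeriv_add_one, mem_derivOp_iff] at hy
  have hyU : y ∈ U := (hUy.symm ▸ rfl : y ∈ U ∩ cbDeriv τ α).1
  obtain ⟨z, hzU, hz, hne⟩ := hy U hU hyU
  have : z ∈ U ∩ cbDeriv τ α := ⟨hzU, hz⟩
  rw [hUy] at this
  exact hne this

theorem IsScattered.isRank (h : IsScattered τ) : IsRank τ (cbRank τ) := by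
  let _ := τ
  have hanti : Antitone (cbDeriv τ) := CantorBendixson.iteratedDerivedSet_antitone _
  have hnot : ∀ x, x ∉ cbDeriv τ (cbRank τ x + 1) := fun x =>
    csInf_mem (s := {α | x ∉ cbDeriv τ (α + 1)}) (h.exists_notMem_cbDeriv x)
  have hlt : ∀ x, ∀ α < cbRank τ x, x ∈ cbDeriv τ (α + 1) := fun x α hα => by
    by_contra hx
    exact notMem_of_lt_csInf' (s := {α | x ∉ cbDeriv τ (α + 1)}) hα hx
  have hmem : ∀ x, x ∈ cbDeriv τ (cbRank τ x) := fun x => by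
    rcases Ordinal.zero_or_succ_or_isSuccLimit (cbRank τ x) with h0 | ⟨β, hβ⟩ | hl
    · rw [h0]
      have : cbDeriv τ 0 = Set.univ := CantorBendixson.iteratedDerivedSet_zero
      rw [this]
      trivial
    · rw [← hβ]
      exact hlt x β (hβ ▸ lt_succ β)
    · have : cbDeriv τ (cbRank τ x) = ⋂ b : Set.Iio (cbRank τ x), cbDeriv τ b :=
        CantorBendixson.iteratedDerivedSet_limit hl
      rw [this, Set.mem_iInter]
      exact fun b => hanti (le_succ b.1) (hlt x b.1 b.2)
  have hlower : ∀ x, ∃ U, IsOpen[τ] U ∧ x ∈ U ∧ ∀ y ∈ U, y ≠ x → cbRank τ y < cbRank τ x := by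
    intro x
    have hx := hnot x
    rw [mem_cbDeriv_add_one, mem_derivOp_iff] at hx
    push Not at hx
    obtain ⟨U, hU, hxU, hy⟩ := hx
    refine ⟨U, hU, hxU, fun y hyU hne => ?_⟩
    by_contra hle
    exact hne (hy y hyU (hanti (not_lt.1 hle) (hmem y)))
  refine ⟨hlower, fun x U hU hxU α hα => ?_⟩
  obtain ⟨V, hV, hxV, hy⟩ := hlower x
  have hx := hlt x α hα
  rw [mem_cbDeriv_add_one, mem_derivOp_iff] at hx
  obtain ⟨y, ⟨hyU, hyV⟩, hyα, hne⟩ := hx (U ∩ V) (IsOpen.inter hU hV) ⟨hxU, hxV⟩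
  refine ⟨y, hyU, ?_, hy y hyV hne⟩
  by_contra hle
  exact hnot y (hanti (add_one_le_iff.2 (not_le.1 hle)) hyα)

theorem IsScattered.mono (h : IsScattered τ) (hσ : σ ≤ τ) : IsScattered σ := by
  intro A hA
  obtain ⟨x, hx, U, hU, e⟩ := h A hA
  exact ⟨x, hx, U, hσ U hU, e⟩

namespace IsLExtension

theorem refl (τ : TopologicalSpace X) : IsLExtension τ τ :=
  ⟨le_rfl, fun _ => rfl, fun U hU _ hx _ => ⟨U, hU, hx, subset_rfl⟩⟩

theorem trans {ν : TopologicalSpace X} (h : IsLExtension τ σ) (h' : IsLExtension σ ν) :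
    IsLExtension τ ν := by
  refine ⟨h'.le.trans h.le, fun x => (h'.rank_eq x).trans (h.rank_eq x), fun U hU x hx hl => ?_⟩
  obtain ⟨V, hV, hxV, hVU⟩ := h'.nonlimit U hU x hx (by rwa [h.rank_eq])
  obtain ⟨W, hW, hxW, hWV⟩ := h.nonlimit V hV x hxV hl
  exact ⟨W, hW, hxW, hWV.trans hVU⟩

theorem isRank (h : IsLExtension τ σ) (hρ : IsRank τ ρ) : IsRank σ ρ := by
  have := (hρ.isScattered.mono h.le).isRank
  have e : cbRank σ = ρ := funext fun x => (h.rank_eq x).trans (hρ.cbRank_eq x)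
  rwa [e] at this

theorem of_isRank (hτ : IsRank τ ρ) (hσ : IsRank σ ρ) (hle : σ ≤ τ)
    (h : ∀ U : Set X, IsOpen[σ] U → ∀ x ∈ U, ¬ IsSuccLimit (ρ x) →
      ∃ V : Set X, IsOpen[τ] V ∧ x ∈ V ∧ V ⊆ U) : IsLExtension τ σ :=
  ⟨hle, fun x => (hσ.cbRank_eq x).trans (hτ.cbRank_eq x).symm, fun U hU x hx hl =>
    h U hU x hx (by rwa [hτ.cbRank_eq] at hl)⟩

end IsLExtension

/-- Along a nonempty chain the neighborhood filters are directed, so a neighborhood for the infimum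
is already one for a member of the chain. Local conditions therefore pass to the limit in Zorn's
lemma. -/
theorem exists_isOpen_of_isOpen_sInf_chain {c : Set (TopologicalSpace X)}
    (hc : IsChain (· ≤ ·) c) (hne : c.Nonempty) {U : Set X} (hU : IsOpen[sInf c] U) {x : X}
    (hx : x ∈ U) : ∃ σ ∈ c, ∃ V, IsOpen[σ] V ∧ x ∈ V ∧ V ⊆ U := by
  have hmem : U ∈ @nhds X (sInf c) x := @IsOpen.mem_nhds X (sInf c) x U hU hx
  rw [nhds_sInf, Filter.mem_biInf_of_directed] at hmem
  · obtain ⟨σ, hσ, hmem⟩ := hmem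
    obtain ⟨V, hVU, hV, hxV⟩ := (@mem_nhds_iff X σ x U).1 hmem
    exact ⟨σ, hσ, V, hV, hxV, hVU⟩
  · intro a ha b hb
    rcases hc.total ha hb with h | h
    · exact ⟨a, ha, le_rfl, nhds_mono h⟩
    · exact ⟨b, hb, nhds_mono h, le_rfl⟩
  · exact hne

/-- Every scattered topology has an ℓ-maximal ℓ-extension. -/
theorem IsScattered.exists_isLMaximal (h : IsScattered τ) :
    ∃ σ, IsLExtension τ σ ∧ IsLMaximal σ := by
  -- The order is dualized because finer topologies are smaller.
  obtain ⟨σ, hσ, hmax⟩ := zorn_le₀ (α := (TopologicalSpace X)ᵒᵈ)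
    {σ | IsLExtension τ (OrderDual.ofDual σ)} (by
      intro c hcs hc
      rcases c.eq_empty_or_nonempty with rfl | hne
      · exact ⟨OrderDual.toDual τ, IsLExtension.refl τ, by simp⟩
      let c' : Set (TopologicalSpace X) := OrderDual.toDual ⁻¹' c
      have hc' : IsChain (· ≤ ·) c' := hc.symm
      have hne' : c'.Nonempty := hne
      have hle : sInf c' ≤ τ := by
        obtain ⟨σ, hσ⟩ := hne'
        exact (sInf_le hσ).trans (hcs hσ).le
      refine ⟨OrderDual.toDual (sInf c'), ?_, fun σ hσ => sInf_le (a := OrderDual.ofDual σ) hσ⟩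
      refine IsLExtension.of_isRank h.isRank ⟨?_, ?_⟩ hle ?_
      · intro x
        obtain ⟨U, hU, hxU, hy⟩ := h.isRank.lower x
        exact ⟨U, hle U hU, hxU, hy⟩
      · intro x U hU hx α hα
        obtain ⟨σ, hσ, V, hV, hxV, hVU⟩ := exists_isOpen_of_isOpen_sInf_chain hc' hne' hU hx
        obtain ⟨y, hyV, hy⟩ := ((hcs hσ).isRank h.isRank).cofinal x V hV hxV α hα
        exact ⟨y, hVU hyV, hy⟩
      · intro U hU x hx hl
        obtain ⟨σ, hσ, V, hV, hxV, hVU⟩ := exists_isOpen_of_isOpen_sInf_chain hc' hne' hU hx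
        obtain ⟨W, hW, hxW, hWV⟩ := (hcs hσ).nonlimit V hV x hxV hl
        exact ⟨W, hW, hxW, hWV.trans hVU⟩)
  refine ⟨OrderDual.ofDual σ, hσ, fun σ' hσ' => ?_⟩
  have := hmax (y := OrderDual.toDual σ') (hσ.trans hσ') hσ'.le
  exact le_antisymm hσ'.le this

/-- In an ℓ-maximal space, the open sets of points of lower rank are decided, up to bounded rank,
by every point of limit rank. -/
theorem IsLMaximal.isOpen_insert_or_bounded (hmax : IsLMaximal τ) (hρ : IsRank τ ρ) {x : X}
    (hx : IsSuccLimit (ρ x)) {V : Set X} (hV : IsOpen[τ] V) (hVx : ∀ y ∈ V, ρ y < ρ x) :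
    IsOpen[τ] (insert x V) ∨
      ∃ U, IsOpen[τ] U ∧ x ∈ U ∧ ∃ α < ρ x, ∀ y ∈ U, y ∈ V → ρ y < α := by
  by_cases hb : ∃ U, IsOpen[τ] U ∧ x ∈ U ∧ ∃ α < ρ x, ∀ y ∈ U, y ∈ V → ρ y < α
  · exact .inr hb
  push Not at hb
  left
  -- Adjoining `insert x V` adds new neighborhoods only at `x`. If `V` has unbounded rank below `ρ
  -- x` near `x`, the ranks do not change, so this is an ℓ-extension and maximality makes `insert x
  -- V` open already.
  let σ : TopologicalSpace X := τ ⊓ TopologicalSpace.generateFrom {insert x V}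
  have hστ : σ ≤ τ := inf_le_left
  have hins : IsOpen[σ] (insert x V) :=
    (inf_le_right : σ ≤ _) _ (TopologicalSpace.isOpen_generateFrom_of_mem rfl)
  have hnhd : ∀ U, IsOpen[σ] U → ∀ y ∈ U, ∃ W, IsOpen[τ] W ∧ y ∈ W ∧
      (W ⊆ U ∨ (y = x ∧ W ∩ V ⊆ U)) := by
    intro U hU y hy
    have hm := (@nhds_inf X τ (TopologicalSpace.generateFrom {insert x V}) y).ge
      (@IsOpen.mem_nhds X σ y U hU hy)
    rw [TopologicalSpace.nhds_generateFrom] at hm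
    obtain ⟨A, hA, B, hB, rfl⟩ := Filter.mem_inf_iff.1 hm
    obtain ⟨W, hWA, hW, hyW⟩ := (@mem_nhds_iff X τ y A).1 hA
    by_cases hyi : y ∈ insert x V
    · have hBs : insert x V ⊆ B := by
        have he : {s | y ∈ s ∧ s ∈ ({insert x V} : Set (Set X))} = {insert x V} := by
          ext s
          constructor
          · exact fun hs => hs.2
          · rintro rfl
            exact ⟨hyi, rfl⟩
        rw [he] at hB
        simpa using hB
      rcases Set.mem_insert_iff.1 hyi with rfl | hyV
      · exact ⟨W, hW, hyW, .inr ⟨rfl, fun z hz => ⟨hWA hz.1, hBs (.inr hz.2)⟩⟩⟩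
      · let _ := τ
        exact ⟨W ∩ V, IsOpen.inter hW hV, ⟨hyW, hyV⟩, .inl fun z hz =>
          ⟨hWA hz.1, hBs (.inr hz.2)⟩⟩
    · have hBu : B = Set.univ := by
        have he : {s | y ∈ s ∧ s ∈ ({insert x V} : Set (Set X))} = ∅ := by
          ext s
          simp only [Set.mem_ofPred_eq, Set.mem_singleton_iff, Set.mem_empty_iff_false, iff_false]
          rintro ⟨h1, rfl⟩
          exact hyi h1
        rw [he] at hB
        simpa using hB
      exact ⟨W, hW, hyW, .inl fun z hz => ⟨hWA hz, hBu ▸ trivial⟩⟩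
  have hσρ : IsRank σ ρ := by
    refine ⟨fun y => ?_, fun y U hU hy α hα => ?_⟩
    · obtain ⟨U, hU, h⟩ := hρ.lower y
      exact ⟨U, hστ U hU, h⟩
    · obtain ⟨W, hW, hyW, hWU | ⟨rfl, hWU⟩⟩ := hnhd U hU y hy
      · obtain ⟨z, hz, h⟩ := hρ.cofinal y W hW hyW α hα
        exact ⟨z, hWU hz, h⟩
      · obtain ⟨z, hzW, hzV, hz⟩ := hb W hW hyW α hα
        exact ⟨z, hWU ⟨hzW, hzV⟩, hz, hVx z hzV⟩
  have hext : IsLExtension τ σ := by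
    refine .of_isRank hρ hσρ hστ fun U hU y hy hl => ?_
    obtain ⟨W, hW, hyW, hWU | ⟨rfl, hWU⟩⟩ := hnhd U hU y hy
    · exact ⟨W, hW, hyW, hWU⟩
    · exact absurd hx hl
  have := hmax σ hext
  rwa [this] at hins

/-- In an ℓ-maximal space, a derived set contains all points of sufficiently large rank near
each of its points. -/
theorem IsLMaximal.exists_of_mem_derivOp (hmax : IsLMaximal τ) (hρ : IsRank τ ρ) {A : Set X}
    {x : X} (hx : x ∈ derivOp τ A) :
    ∃ U, IsOpen[τ] U ∧ x ∈ U ∧ ∃ α < ρ x, ∀ y ∈ U, α < ρ y → y ∈ derivOp τ A := by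
  let _ := τ
  obtain ⟨U₀, hU₀, hxU₀, hlt⟩ := hρ.lower x
  have hx' := mem_derivOp_iff.1 hx
  rcases Ordinal.zero_or_succ_or_isSuccLimit (ρ x) with h0 | ⟨β, hβ⟩ | hl
  · obtain ⟨y, hy, -, hne⟩ := hx' U₀ hU₀ hxU₀
    have := hlt y hy hne
    rw [h0] at this
    exact absurd this not_lt_zero
  · refine ⟨U₀, hU₀, hxU₀, β, hβ ▸ lt_succ β, fun y hy hβy => ?_⟩
    by_cases hne : y = x
    · exact hne ▸ hx
    · have := hlt y hy hne
      rw [← hβ, lt_succ_iff] at this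
      exact absurd hβy this.not_gt
  -- the points of `A` that are isolated in `A`
  let B : Set X := {y | y ∈ A ∧ ρ y < ρ x ∧ ∃ U, IsOpen[τ] U ∧ y ∈ U ∧ ∀ z ∈ U, z ∈ A → z = y}
  have hBA : derivOp τ B ⊆ derivOp τ A := fun y hy => mem_derivOp_iff.2 fun U hU hyU => by
    obtain ⟨z, hz, hzB, hne⟩ := mem_derivOp_iff.1 hy U hU hyU
    exact ⟨z, hz, hzB.1, hne⟩
  have hxB : ∀ U, IsOpen[τ] U → x ∈ U → ∃ y ∈ U, y ∈ B := by
    intro U hU hxU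
    obtain ⟨y, ⟨hyU, hyU₀⟩, hyA, hne⟩ := hx' (U ∩ U₀) (IsOpen.inter hU hU₀) ⟨hxU, hxU₀⟩
    obtain ⟨z, ⟨hzU, hzA, hzx⟩, hmin⟩ :=
      (InvImage.wf ρ (wellFounded_lt (α := Ordinal.{u}))).has_min
        {z | z ∈ U ∧ z ∈ A ∧ ρ z < ρ x} ⟨y, hyU, hyA, hlt y hyU₀ hne⟩
    obtain ⟨V, hV, hzV, hVU, hVz⟩ := hρ.exists_isOpen_subset hU hzU
    refine ⟨z, hzU, hzA, hzx, V, hV, hzV, fun w hwV hwA => ?_⟩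
    by_contra hwz
    have hw := hVz w hwV hwz
    exact hmin w ⟨hVU hwV, hwA, hw.trans hzx⟩ hw
  -- `B` meets every neighborhood of `x` and `V` avoids it, so `insert x V` cannot be open; hence
  -- `V` has bounded rank near `x`.
  let V : Set X := {y | ρ y < ρ x ∧ ∃ U, IsOpen[τ] U ∧ y ∈ U ∧ ∀ z ∈ U, z ∉ B}
  have hV : IsOpen[τ] V := isOpen_of_forall_exists fun y ⟨hyx, U, hU, hyU, hUB⟩ =>
    ⟨U ∩ {z | ρ z < ρ x}, IsOpen.inter hU (hρ.isOpen_lt _), ⟨hyU, hyx⟩, fun z hz =>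
      ⟨hz.2, U, hU, hz.1, hUB⟩⟩
  rcases hmax.isOpen_insert_or_bounded hρ hl hV (fun y hy => hy.1) with
    hins | ⟨U, hU, hxU, α, hα, hUα⟩
  · obtain ⟨y, hy, hyB⟩ := hxB _ hins (Set.mem_insert _ _)
    rcases Set.mem_insert_iff.1 hy with rfl | ⟨-, W, -, hyW, hWB⟩
    · exact absurd hyB.2.1 (lt_irrefl _)
    · exact absurd hyB (hWB y hyW)
  · refine ⟨U ∩ U₀, IsOpen.inter hU hU₀, ⟨hxU, hxU₀⟩, α, hα, fun y ⟨hyU, hyU₀⟩ hαy => ?_⟩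
    by_cases hyx : y = x
    · exact hyx ▸ hx
    have hylt := hlt y hyU₀ hyx
    by_contra hyA
    have hyB : y ∉ derivOp τ B := fun h => hyA (hBA h)
    rw [mem_derivOp_iff] at hyB
    push Not at hyB
    obtain ⟨W, hW, hyW, hWB⟩ := hyB
    obtain ⟨W', hW', hyW', hW'W, hW'lt⟩ :=
      hρ.exists_isOpen_subset (IsOpen.inter hW hU) ⟨hyW, hyU⟩
    -- If `y` were not a limit of `B`, points of rank at least `α` below `y` would lie in `V`,
    -- against the bound.
    obtain ⟨z, hzW', hαz, hzy⟩ := hρ.cofinal y W' hW' hyW' α hαy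
    have hzV : z ∈ V := by
      refine ⟨hzy.trans hylt, W' ∩ {z | ρ z < ρ y}, IsOpen.inter hW' (hρ.isOpen_lt _),
        ⟨hzW', hzy⟩, fun w ⟨hwW', hwy⟩ hwB => ?_⟩
      have := hWB w (hW'W hwW').1 hwB
      subst this
      exact lt_irrefl (ρ w) hwy
    exact (hUα z (hW'W hzW').2 hzV).not_ge hαz

theorem plusTopology_le (τ : TopologicalSpace X) : plusTopology τ ≤ τ := fun _ hU =>
  TopologicalSpace.isOpen_generateFrom_of_mem (.inl hU)

theorem isOpen_plusTopology_derivOp (τ : TopologicalSpace X) (A : Set X) :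
    IsOpen[plusTopology τ] (derivOp τ A) :=
  TopologicalSpace.isOpen_generateFrom_of_mem (.inr ⟨A, rfl⟩)

theorem IsRank.isOpen_plusTopology_gt (hρ : IsRank τ ρ) (α : Ordinal.{u}) :
    IsOpen[plusTopology τ] {x | α < ρ x} := by
  have : {x | α < ρ x} = derivOp τ (cbDeriv τ α) := by
    ext x
    rw [← mem_cbDeriv_add_one, hρ.cbDeriv_eq]
    exact (add_one_le_iff (x := α)).symm
  rw [this]
  exact isOpen_plusTopology_derivOp τ _

/-- Neighborhoods in `τ⁺` for an ℓ-maximal `τ`. -/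
theorem IsLMaximal.exists_of_isOpen_plusTopology (hmax : IsLMaximal τ) (hρ : IsRank τ ρ)
    {V : Set X} (hV : IsOpen[plusTopology τ] V) {x : X} (hx : x ∈ V) :
    ∃ U, IsOpen[τ] U ∧ x ∈ U ∧ ∃ β ≤ ρ x, ¬ IsSuccLimit β ∧ ∀ y ∈ U, β ≤ ρ y → y ∈ V := by
  let _ := τ
  induction hV with
  | basic s hs =>
    rcases hs with hs | ⟨A, rfl⟩
    · exact ⟨s, hs, hx, 0, zero_le, Ordinal.not_isSuccLimit_zero, fun y hy _ => hy⟩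
    · obtain ⟨U, hU, hxU, α, hα, h⟩ := hmax.exists_of_mem_derivOp hρ hx
      exact ⟨U, hU, hxU, succ α, succ_le_of_lt hα, not_isSuccLimit_succ α,
        fun y hy hαy => h y hy (succ_le_iff.1 hαy)⟩
  | univ =>
    exact ⟨Set.univ, isOpen_univ, trivial, 0, zero_le, Ordinal.not_isSuccLimit_zero,
      fun _ _ _ => trivial⟩
  | inter s t _ _ ihs iht =>
    obtain ⟨U, hU, hxU, α, hα, hαl, h⟩ := ihs hx.1
    obtain ⟨U', hU', hxU', α', hα', hαl', h'⟩ := iht hx.2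
    refine ⟨U ∩ U', IsOpen.inter hU hU', ⟨hxU, hxU'⟩, max α α', max_le hα hα', ?_,
      fun y hy hαy => ⟨h y hy.1 ((le_max_left _ _).trans hαy),
        h' y hy.2 ((le_max_right _ _).trans hαy)⟩⟩
    rcases max_choice α α' with e | e <;> rwa [e]
  | sUnion S _ ih =>
    obtain ⟨s, hs, hxs⟩ := hx
    obtain ⟨U, hU, hxU, α, hα, hαl, h⟩ := ih s hs hxs
    exact ⟨U, hU, hxU, α, hα, hαl, fun y hy hαy => ⟨s, hs, h y hy hαy⟩⟩

end ScatteredTopology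

/-! ### The tower of iterated end-logarithms. -/

section RankTower

open Order Ordinal

variable {X : Type u} {τ : TopologicalSpace X} {ρ : X → Ordinal.{u}}

/-- `r` is continuous, open onto left neighborhoods, and pointwise discrete as a map to the
ordinals with the interval topology. -/
structure IsOrdinalDMap (τ : TopologicalSpace X) (r : X → Ordinal.{u}) : Prop where
  isOpen_lt : ∀ β, IsOpen[τ] {x | r x < β}
  isOpen_gt : ∀ β, IsOpen[τ] {x | β < r x}
  discrete : ∀ x, ∃ U, IsOpen[τ] U ∧ x ∈ U ∧ ∀ y ∈ U, r y = r x → y = x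
  open_map : ∀ x U, IsOpen[τ] U → x ∈ U → r x ≠ 0 →
    ∃ δ < r x, ∀ ξ, δ < ξ → ξ ≤ r x → ∃ y ∈ U, r y = ξ

theorem IsOrdinalDMap.isOpen_Ioc {r : X → Ordinal.{u}} (h : IsOrdinalDMap τ r)
    (γ β : Ordinal.{u}) : IsOpen[τ] {x | γ < r x ∧ r x ≤ β} := by
  let _ := τ
  have : {x | γ < r x ∧ r x ≤ β} = {x | γ < r x} ∩ {x | r x < succ β} := by
    ext x
    simp
  rw [this]
  exact IsOpen.inter (h.isOpen_gt γ) (h.isOpen_lt _)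

/-- Let `r x = δ + ω ^ e`. The ordinals in `(δ, r x)` are `δ + η` with `0 < η < ω ^ e`, so their
end-logarithms lie below `e`; the ordinals `δ + η + ω ^ α`, `α < e`, come arbitrarily close to `r x`
and realize every smaller value. -/
theorem IsOrdinalDMap.isRank {r : X → Ordinal.{u}} (h : IsOrdinalDMap τ r) :
    IsRank τ fun x => endLog (r x) := by
  let _ := τ
  refine ⟨fun x => ?_, fun x U hU hxU α hα => ?_⟩
  · obtain ⟨U, hU, hxU, hdisc⟩ := h.discrete x
    by_cases h0 : r x = 0
    · refine ⟨U ∩ {y | r y < 1}, IsOpen.inter hU (h.isOpen_lt 1), ⟨hxU, by simp [h0]⟩, ?_⟩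
      rintro y ⟨hyU, hy⟩ hne
      exact absurd (hdisc y hyU (by rw [h0]; exact Order.lt_one_iff.1 hy)) hne
    · obtain ⟨δ, hδ⟩ := exists_eq_add_opow_endLog h0
      have hpos : δ < r x := by
        rw [hδ]
        exact lt_add_of_pos_right _ (opow_pos _ omega0_pos)
      refine ⟨U ∩ {y | δ < r y ∧ r y ≤ r x}, IsOpen.inter hU (h.isOpen_Ioc _ _),
        ⟨hxU, hpos, le_rfl⟩, ?_⟩
      rintro y ⟨hyU, hδy, hyx⟩ hne
      have hlt : r y < r x := lt_of_le_of_ne hyx fun e => hne (hdisc y hyU e)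
      obtain ⟨η, hη⟩ := exists_add_of_le hδy.le
      have hη0 : η ≠ 0 := by
        rintro rfl
        rw [hη, add_zero] at hδy
        exact lt_irrefl _ hδy
      rw [hη, endLog_add _ hη0]
      rw [hη, hδ] at hlt
      exact endLog_lt hη0 (by simpa using hlt)
  · have h0 : r x ≠ 0 := by
      intro e
      simp only [e, endLog_zero] at hα
      exact not_lt_zero hα
    obtain ⟨δ, hδ⟩ := exists_eq_add_opow_endLog h0
    obtain ⟨δ', hδ', hop⟩ := h.open_map x U hU hxU h0
    have key : ∃ η < ω ^ endLog (r x), δ' ≤ δ + η := by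
      rw [hδ] at hδ'
      rcases le_total δ' δ with hle | hle
      · exact ⟨0, opow_pos _ omega0_pos, by simpa using hle⟩
      · obtain ⟨η, rfl⟩ := exists_add_of_le hle
        exact ⟨η, by simpa using hδ', le_rfl⟩
    obtain ⟨η, hη, hδη⟩ := key
    have hαω : ω ^ α < ω ^ endLog (r x) := (opow_lt_opow_iff_right one_lt_omega0).2 hα
    have hsum : η + ω ^ α < ω ^ endLog (r x) := isPrincipal_add_omega0_opow _ hη hαω
    obtain ⟨y, hyU, hy⟩ := hop (δ + (η + ω ^ α))
      (by
        rw [← add_assoc]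
        exact hδη.trans_lt (lt_add_of_pos_right _ (opow_pos _ omega0_pos)))
      (by
        conv_rhs => rw [hδ]
        exact (by simpa using hsum.le))
    have hyα : endLog (r y) = α := by
      rw [hy, ← add_assoc, endLog_add_omega0_opow]
    exact ⟨y, hyU, hyα.ge, hyα.trans_lt hα⟩

/-- A τ⁺-neighborhood of `x` contains all points of rank at least some `β ≤ ρ x` in a
τ-neighborhood, and there every rank up to `ρ x` occurs. -/
theorem IsLMaximal.isOrdinalDMap_plusTopology (hmax : IsLMaximal τ) (hρ : IsRank τ ρ) :
    IsOrdinalDMap (plusTopology τ) ρ := by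
  refine ⟨fun β => plusTopology_le τ _ (hρ.isOpen_lt β), hρ.isOpen_plusTopology_gt, fun x => ?_,
    fun x V hV hx h0 => ?_⟩
  · obtain ⟨U, hU, hxU, hlt⟩ := hρ.lower x
    refine ⟨U, plusTopology_le τ _ hU, hxU, fun y hyU e => ?_⟩
    by_contra hne
    exact (hlt y hyU hne).ne e
  · obtain ⟨U, hU, hxU, β, hβ, hβl, hV'⟩ := hmax.exists_of_isOpen_plusTopology hρ hV hx
    -- Since `β` is not a limit, `β ≤ ξ` follows from a strict bound `δ < ξ` with `δ < ρ x`.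
    have key : ∃ δ < ρ x, ∀ ξ, δ < ξ → β ≤ ξ := by
      rcases zero_or_succ_or_isSuccLimit β with rfl | ⟨α, rfl⟩ | hl
      · exact ⟨0, pos_iff_ne_zero.2 h0, fun _ _ => zero_le⟩
      · exact ⟨α, succ_le_iff.1 hβ, fun _ h => succ_le_of_lt h⟩
      · exact absurd hl hβl
    obtain ⟨δ, hδ, hδβ⟩ := key
    refine ⟨δ, hδ, fun ξ h1 h2 => ?_⟩
    obtain ⟨y, hyU, hy⟩ := hρ.exists_rank_eq hU hxU h2
    exact ⟨y, hV' y hyU (hy ▸ hδβ ξ h1), hy⟩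

/-- The position of an element of an ordinal. -/
noncomputable def Ordinal.ToType.pos {o : Ordinal.{u}} (x : o.ToType) : Ordinal.{u} :=
  typein (α := o.ToType) (· < ·) x

theorem isOrdinalDMap_pos (o : Ordinal.{u}) :
    IsOrdinalDMap (Preorder.topology o.ToType) ToType.pos := by
  let _ := Preorder.topology o.ToType
  have _ : OrderTopology o.ToType := ⟨rfl⟩
  have hmono : ∀ x y : o.ToType, x.pos < y.pos ↔ x < y := fun x y => typein_lt_typein _
  have hsurj : ∀ β < o, ∃ x : o.ToType, x.pos = β := fun β hβ =>
    typein_surj _ (by rwa [type_toType])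
  have hlt : ∀ x : o.ToType, x.pos < o := fun x => typein_lt_self x
  refine ⟨fun β => ?_, fun β => ?_, fun x => ⟨Set.univ, isOpen_univ, trivial, fun y _ h => ?_⟩,
    fun x U hU hxU h0 => ?_⟩
  · by_cases hβ : β < o
    · obtain ⟨b, rfl⟩ := hsurj β hβ
      simp only [hmono]
      exact isOpen_Iio
    · have : {x : o.ToType | x.pos < β} = Set.univ :=
        Set.eq_univ_of_forall fun x => (hlt x).trans_le (not_lt.1 hβ)
      rw [this]
      exact isOpen_univ
  · by_cases hβ : β < o
    · obtain ⟨b, rfl⟩ := hsurj β hβ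
      simp only [hmono]
      exact isOpen_Ioi
    · have : {x : o.ToType | β < x.pos} = ∅ :=
        Set.eq_empty_of_forall_notMem fun x hx => hβ (lt_trans hx (hlt x))
      rw [this]
      exact isOpen_empty
  · exact typein_injective _ h
  · obtain ⟨z, hz⟩ := hsurj 0 ((pos_iff_ne_zero.2 h0).trans (hlt x))
    have hzx : z < x := by
      rw [← hmono, hz]
      exact pos_iff_ne_zero.2 h0
    obtain ⟨l, hl, hU'⟩ := exists_Ioc_subset_of_mem_nhds (hU.mem_nhds hxU) ⟨z, hzx⟩
    refine ⟨l.pos, (hmono _ _).2 hl, fun ξ h1 h2 => ?_⟩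
    obtain ⟨y, rfl⟩ := hsurj ξ (h2.trans_lt (hlt x))
    exact ⟨y, hU' ⟨(hmono _ _).1 h1, not_lt.1 fun h => h2.not_gt ((hmono _ _).2 h)⟩, rfl⟩

/-- The topologies `b n`, `τ n` and ordinal-valued functions `r n` arising from an lme-space:
`τ n` is the `n`-th topology, `b n` the topology it extends, and `r (n + 1)` its rank function. -/
structure RankTower (b τ : ℕ → TopologicalSpace X) (r : ℕ → X → Ordinal.{u}) : Prop where
  dmap : ∀ n, IsOrdinalDMap (b n) (r n)
  le : ∀ n, τ n ≤ b n
  succ_le : ∀ n, b (n + 1) ≤ τ n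
  rank : ∀ n, IsRank (τ n) (r (n + 1))
  rank_eq : ∀ n x, r (n + 1) x = endLog (r n x)
  nonlimit : ∀ n U, IsOpen[τ n] U → ∀ x ∈ U, ¬ IsSuccLimit (r (n + 1) x) →
    ∃ V, IsOpen[b n] V ∧ x ∈ V ∧ V ⊆ U

namespace RankTower

variable {b τ : ℕ → TopologicalSpace X} {r : ℕ → X → Ordinal.{u}}

theorem le_of_le (h : RankTower b τ r) {m n : ℕ} (hmn : n ≤ m) : τ m ≤ b n := by
  induction m, hmn using Nat.le_induction with
  | base => exact h.le n
  | succ m _ ih => exact ((h.le _).trans (h.succ_le m)).trans ih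

theorem antitone (h : RankTower b τ r) : Antitone τ :=
  antitone_nat_of_succ_le fun n => (h.le (n + 1)).trans (h.succ_le n)

end RankTower

/-- The topologies extended by the successive members of an lme-space. -/
@[reducible]
def lmeBase (τb : TopologicalSpace X) (τ : ℕ → TopologicalSpace X) : ℕ → TopologicalSpace X
  | 0 => τb
  | n + 1 => plusTopology (τ n)

/-- A d-map at level `n` determines the rank there as its end-logarithm, and ℓ-maximality makes this
rank the d-map at level `n + 1`. -/
theorem IsLmeSpace.rankTower {τb : TopologicalSpace X} {τ : ℕ → TopologicalSpace X}
    (h : IsLmeSpace τb τ) {r₀ : X → Ordinal.{u}} (hr : IsOrdinalDMap τb r₀) :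
    RankTower (lmeBase τb τ) τ fun n x => endLog^[n] (r₀ x) := by
  have hext : ∀ n, IsLExtension (lmeBase τb τ n) (τ n) := fun n => by
    cases n with
    | zero => exact h.zero_ext
    | succ n => exact h.succ_ext n
  have hmax : ∀ n, IsLMaximal (τ n) := fun n => by
    cases n with
    | zero => exact h.zero_max
    | succ n => exact h.succ_max n
  have hrank : ∀ n, IsOrdinalDMap (lmeBase τb τ n) (fun x => endLog^[n] (r₀ x)) →
      IsRank (τ n) fun x => endLog^[n + 1] (r₀ x) := fun n hn => by
    simp only [Function.iterate_succ_apply']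
    exact (hext n).isRank hn.isRank
  have hd : ∀ n, IsOrdinalDMap (lmeBase τb τ n) fun x => endLog^[n] (r₀ x) := fun n => by
    induction n with
    | zero => exact hr
    | succ n ih => exact (hmax n).isOrdinalDMap_plusTopology (hrank n ih)
  refine ⟨hd, fun n => (hext n).le, fun n => plusTopology_le _, fun n => hrank n (hd n),
    fun n x => Function.iterate_succ_apply' _ _ _, fun n U hU x hx hl => ?_⟩
  refine (hext n).nonlimit U hU x hx ?_
  rwa [(hd n).isRank.cbRank_eq, ← Function.iterate_succ_apply' endLog]

theorem exists_isLmeSpace {τb : TopologicalSpace X} (h : IsScattered τb) :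
    ∃ τ, IsLmeSpace τb τ := by
  choose F hF hmax using fun σ : {σ : TopologicalSpace X // IsScattered σ} =>
    σ.2.exists_isLMaximal
  have hplus : ∀ σ : {σ : TopologicalSpace X // IsScattered σ}, IsScattered (plusTopology (F σ)) :=
    fun σ => σ.2.mono ((plusTopology_le _).trans (hF σ).le)
  let s : ℕ → {σ : TopologicalSpace X // IsScattered σ} := fun n =>
    Nat.rec ⟨τb, h⟩ (fun _ σ => ⟨plusTopology (F σ), hplus σ⟩) n
  exact ⟨fun n => F (s n), h, hF (s 0), hmax (s 0), fun n => hF (s (n + 1)),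
    fun n => hmax (s (n + 1))⟩

end RankTower

/-! ### Maximal consistent theories of GLP. -/

section CanonicalWorlds

open ModalFormula

/-- A set of formulas that contains the theorems of GLP and is closed under modus ponens. -/
structure IsGLPTheory (T : Set ModalFormula) : Prop where
  thm : ∀ φ, GLPProvable φ → φ ∈ T
  mp : ∀ φ ψ, φ ∈ T → imp φ ψ ∈ T → ψ ∈ T

/-- A maximal consistent theory over GLP. -/
structure IsGLPMaximal (w : Set ModalFormula) : Prop extends IsGLPTheory w where
  bot_notMem : bot ∉ w
  total : ∀ φ, φ ∈ w ∨ neg φ ∈ w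

/-- The maximal consistent theories over GLP. -/
abbrev GLPWorld := {w : Set ModalFormula // IsGLPMaximal w}

namespace IsGLPTheory

variable {T : Set ModalFormula}

theorem of_taut (h : IsGLPTheory T) {φ : ModalFormula} (hφ : IsTautology φ) : φ ∈ T :=
  h.thm φ (.taut hφ)

theorem imp_of_mem (h : IsGLPTheory T) {φ : ModalFormula} (ψ : ModalFormula) (hφ : φ ∈ T) :
    imp ψ φ ∈ T := by
  refine h.mp _ _ hφ (h.of_taut fun e hb hi => ?_)
  simp only [hi]
  tauto

/-- Deduction theorem: the theory obtained by adding a hypothesis. -/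
theorem adjoin (h : IsGLPTheory T) (ψ : ModalFormula) : IsGLPTheory {χ | imp ψ χ ∈ T} := by
  refine ⟨fun φ hφ => h.imp_of_mem _ (h.thm φ hφ), fun φ χ h1 h2 => ?_⟩
  refine h.mp _ _ h1 (h.mp _ _ h2 (h.of_taut fun e hb hi => ?_))
  simp only [hi]
  tauto

/-- Lindenbaum's lemma, maximizing among theories that omit `φ`. Maximality puts `ψ → φ` into `w`
for each `ψ ∉ w`, so omitting both `ψ` and `¬ψ` would yield `φ`. -/
theorem exists_maximal (h : IsGLPTheory T) {φ : ModalFormula} (hφ : φ ∉ T) :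
    ∃ w : GLPWorld, T ⊆ w.1 ∧ φ ∉ w.1 := by
  obtain ⟨w, hTw, ⟨hw, hφw⟩, hmax⟩ := zorn_subset_nonempty
    {T' | IsGLPTheory T' ∧ φ ∉ T'} (by
      intro c hcs hc hne
      refine ⟨⋃₀ c, ⟨⟨fun ψ hψ => ?_, fun ψ χ h1 h2 => ?_⟩, ?_⟩, fun s hs =>
        Set.subset_sUnion_of_mem hs⟩
      · obtain ⟨s, hs⟩ := hne
        exact ⟨s, hs, (hcs hs).1.thm ψ hψ⟩
      · obtain ⟨s, hs, h1⟩ := h1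
        obtain ⟨t, ht, h2⟩ := h2
        rcases hc.total hs ht with hle | hle
        · exact ⟨t, ht, (hcs ht).1.mp ψ χ (hle h1) h2⟩
        · exact ⟨s, hs, (hcs hs).1.mp ψ χ h1 (hle h2)⟩
      · rintro ⟨s, hs, hφs⟩
        exact (hcs hs).2 hφs) T ⟨h, hφ⟩
  have hadj : ∀ ψ, ψ ∉ w → imp ψ φ ∈ w := by
    intro ψ hψ
    by_contra hn
    have hsub : w ⊆ {χ | imp ψ χ ∈ w} := fun χ hχ => hw.imp_of_mem _ hχ
    refine hψ (hmax (y := {χ | imp ψ χ ∈ w}) ⟨hw.adjoin ψ, hn⟩ hsub ?_)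
    refine hw.of_taut fun e hb hi => ?_
    simp only [hi]
    tauto
  refine ⟨⟨w, hw, fun hb => hφw ?_, fun ψ => ?_⟩, hTw, hφw⟩
  · refine hw.mp _ _ hb (hw.of_taut fun e hb hi => ?_)
    simp only [hi]
    tauto
  · by_contra hn
    push Not at hn
    refine hφw (hw.mp _ _ (hadj _ hn.2) (hw.mp _ _ (hadj _ hn.1) (hw.of_taut fun e hb hi => ?_)))
    simp only [hi, neg]
    tauto

theorem box_mono (h : IsGLPTheory T) (n : ℕ) {φ ψ : ModalFormula}
    (hp : GLPProvable (imp φ ψ)) (hφ : box n φ ∈ T) : box n ψ ∈ T :=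
  h.mp _ _ hφ (h.mp _ _ (h.thm _ (.nec n hp)) (h.thm _ (.distr n φ ψ)))

theorem box_of_lt (h : IsGLPTheory T) {m n : ℕ} (hmn : m < n) {φ : ModalFormula}
    (hφ : box m φ ∈ T) : box n φ ∈ T :=
  h.mp _ _ hφ (h.thm _ (.mono hmn φ))

theorem box_of_le (h : IsGLPTheory T) {m n : ℕ} (hmn : m ≤ n) {φ : ModalFormula}
    (hφ : box m φ ∈ T) : box n φ ∈ T := by
  rcases hmn.lt_or_eq with hlt | rfl
  · exact h.box_of_lt hlt hφ
  · exact hφ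

theorem box_mp (h : IsGLPTheory T) {n : ℕ} {φ ψ : ModalFormula} (hφ : box n φ ∈ T)
    (hi : box n (imp φ ψ) ∈ T) : box n ψ ∈ T :=
  h.mp _ _ hφ (h.mp _ _ hi (h.thm _ (.distr n φ ψ)))

/-- Transitivity, derived from the Löb scheme. -/
theorem box_box (h : IsGLPTheory T) {n : ℕ} {φ : ModalFormula} (hφ : box n φ ∈ T) :
    box n (box n φ) ∈ T := by
  -- `χ` encodes `φ ∧ [n]φ`, to which Löb's axiom is applied.
  let χ : ModalFormula := neg (imp φ (neg (box n φ)))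
  have hχ₁ : GLPProvable (imp χ φ) := .taut fun e hb hi => by
    simp only [χ, neg, hi]
    tauto
  have hχ₂ : GLPProvable (imp χ (box n φ)) := .taut fun e hb hi => by
    simp only [χ, neg, hi]
    tauto
  have hdist : GLPProvable (imp (box n χ) (box n φ)) := .mp (.nec n hχ₁) (.distr n χ φ)
  have hstep : GLPProvable (imp φ (imp (box n χ) χ)) :=
    .mp hdist (.taut fun e hb hi => by
      simp only [χ, neg, hi]
      tauto)
  have hloeb : box n χ ∈ T := h.mp _ _ (h.box_mono n hstep hφ) (h.thm _ (.loeb n χ))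
  exact h.box_mono n hχ₂ hloeb

theorem box_box_of_lt (h : IsGLPTheory T) {m n : ℕ} (hmn : m < n) {φ : ModalFormula}
    (hφ : box m φ ∈ T) : box n (box m φ) ∈ T :=
  h.box_of_lt hmn (h.box_box hφ)

theorem box_neg_box (h : IsGLPTheory T) {m n : ℕ} (hmn : m < n) {φ : ModalFormula}
    (hφ : neg (box m φ) ∈ T) : box n (neg (box m φ)) ∈ T := by
  have h1 : GLPProvable (imp (box m (neg (neg φ))) (box m φ)) :=
    .mp (.nec m (.taut fun e hb hi => by
      simp only [neg, hi]
      tauto)) (.distr m _ _)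
  have h2 : GLPProvable (imp (box m φ) (box m (neg (neg φ)))) :=
    .mp (.nec m (.taut fun e hb hi => by
      simp only [neg, hi]
      tauto)) (.distr m _ _)
  have h3 : GLPProvable (imp (neg (box m φ)) (dia m (neg φ))) :=
    .mp h1 (.taut fun e hb hi => by
      simp only [neg, dia, hi]
      tauto)
  have h4 : GLPProvable (imp (dia m (neg φ)) (neg (box m φ))) :=
    .mp h2 (.taut fun e hb hi => by
      simp only [neg, dia, hi]
      tauto)
  exact h.box_mono n h4 (h.mp _ _ (h.mp _ _ hφ (h.thm _ h3)) (h.thm _ (.negIntro hmn _)))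

end IsGLPTheory

namespace IsGLPMaximal

variable {w : Set ModalFormula}

theorem neg_mem_iff (h : IsGLPMaximal w) (φ : ModalFormula) : neg φ ∈ w ↔ φ ∉ w :=
  ⟨fun hn hφ => h.bot_notMem (h.mp _ _ hφ hn), fun hφ => (h.total φ).resolve_left hφ⟩

theorem imp_mem_iff (h : IsGLPMaximal w) (φ ψ : ModalFormula) :
    imp φ ψ ∈ w ↔ (φ ∈ w → ψ ∈ w) := by
  refine ⟨fun hi hφ => h.mp _ _ hφ hi, fun hi => ?_⟩
  by_cases hφ : φ ∈ w
  · exact h.imp_of_mem _ (hi hφ)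
  · refine h.mp _ _ ((h.neg_mem_iff φ).2 hφ) (h.of_taut fun e hb he => ?_)
    simp only [he, neg]
    tauto

end IsGLPMaximal

/-- The canonical accessibility relation of the modality `n`, without irreflexivity. -/
structure CanonicalRel (n : ℕ) (w v : GLPWorld) : Prop where
  mem : ∀ φ, box n φ ∈ w.1 → φ ∈ v.1
  box_mem : ∀ φ, box n φ ∈ w.1 → box n φ ∈ v.1
  box_mem_iff : ∀ m < n, ∀ φ, box m φ ∈ w.1 ↔ box m φ ∈ v.1

/-- Löb's axiom keeps `ψ` out of the theory of all `χ` with `[n]([n]ψ → χ) ∈ w`, so the successor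
refuting `ψ` can be chosen to contain `[n]ψ`. It thus has fewer false boxes than `w`, which drives
the later induction. -/
theorem exists_canonicalRel {n : ℕ} {w : GLPWorld} {ψ : ModalFormula} (hψ : box n ψ ∉ w.1) :
    ∃ v, CanonicalRel n w v ∧ box n ψ ∈ v.1 ∧ ψ ∉ v.1 := by
  have hw := w.2.toIsGLPTheory
  let T : Set ModalFormula := {χ | box n (imp (box n ψ) χ) ∈ w.1}
  have hT : IsGLPTheory T := by
    refine ⟨fun φ hφ => hw.thm _ (.nec n (.mp hφ (.taut fun e hb hi => ?_))),
      fun φ χ h1 h2 => hw.box_mp h1 (hw.box_mono n (.taut fun e hb hi => ?_) h2)⟩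
    all_goals
      simp only [hi]
      tauto
  have hbox : ∀ χ, box n χ ∈ w.1 → χ ∈ T := fun χ hχ =>
    hw.box_mono n (.taut fun e hb hi => by
      simp only [hi]
      tauto) hχ
  have hψT : ψ ∉ T := fun h => hψ (hw.mp _ _ h (hw.thm _ (.loeb n ψ)))
  obtain ⟨v, hTv, hψv⟩ := hT.exists_maximal hψT
  refine ⟨v, ⟨fun φ hφ => hTv (hbox φ hφ), fun φ hφ => hTv (hbox _ (hw.box_box hφ)),
    fun m hm φ => ⟨fun hφ => hTv (hbox _ (hw.box_box_of_lt hm hφ)), fun hφ => ?_⟩⟩,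
    hTv (hw.thm _ (.nec n (.taut fun e hb hi => ?_))), hψv⟩
  · by_contra hn
    have := hTv (hbox _ (hw.box_neg_box hm ((w.2.neg_mem_iff _).2 hn)))
    exact (v.2.neg_mem_iff _).1 this hφ
  · simp only [hi]
    tauto

theorem exists_world_of_not_provable {φ : ModalFormula} (hφ : ¬ GLPProvable φ) :
    ∃ w : GLPWorld, φ ∉ w.1 := by
  have hT : IsGLPTheory GLP := ⟨fun _ h => h, fun _ _ h1 h2 => .mp h1 h2⟩
  obtain ⟨w, -, hw⟩ := hT.exists_maximal hφ
  exact ⟨w, hw⟩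

end CanonicalWorlds

/-! ### Labelling intervals of ordinals by worlds. -/

section Labelling

open Order Ordinal ModalFormula

variable {X : Type}

/-- At the point `x`, the labels on `S` decide the formulas `[m]ψ`, `ψ ∈ Ψ`, as the
semantics of derived sets prescribes. -/
def LabelsAt (τ : TopologicalSpace X) (Ψ : Finset ModalFormula) (m : ℕ) (S : Set X)
    (F : X → GLPWorld) (x : X) : Prop :=
  ∀ ψ ∈ Ψ, box m ψ ∈ (F x).1 ↔
    ∃ U, IsOpen[τ] U ∧ x ∈ U ∧ U ⊆ S ∧ ∀ y ∈ U, y ≠ x → ψ ∈ (F y).1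

/-- Correctness is local: it may be checked on an open piece of `S`, with any labelling that agrees
there. -/
theorem LabelsAt.of_isOpen {τ : TopologicalSpace X} {Ψ : Finset ModalFormula} {m : ℕ}
    {S S' : Set X} {F F' : X → GLPWorld} {x : X} (h : LabelsAt τ Ψ m S' F' x)
    (hS' : IsOpen[τ] S') (hsub : S' ⊆ S) (hx : x ∈ S') (hF : ∀ y ∈ S', F y = F' y) :
    LabelsAt τ Ψ m S F x := by
  let _ := τ
  intro ψ hψ
  rw [hF x hx, h ψ hψ]
  constructor
  · rintro ⟨U, hU, hxU, hUS, hy⟩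
    exact ⟨U, hU, hxU, hUS.trans hsub, fun y hyU hne => by
      rw [hF y (hUS hyU)]
      exact hy y hyU hne⟩
  · rintro ⟨U, hU, hxU, hUS, hy⟩
    exact ⟨U ∩ S', IsOpen.inter hU hS', ⟨hxU, hx⟩, Set.inter_subset_right, fun y hyU hne => by
      rw [← hF y hyU.2]
      exact hy y hyU.1 hne⟩

variable (b τ : ℕ → TopologicalSpace X) (r : ℕ → X → Ordinal.{0}) (Ψ : Finset ModalFormula)
  (N : ℕ)

/-- The labelling `f` of the interval `(0, l]` is correct for the modalities `m ∈ [n, N)`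
when it is transported by `r n` to any `b n`-open set. -/
def GoodLabelling (n : ℕ) (l : Ordinal.{0}) (f : Ordinal.{0} → GLPWorld) : Prop :=
  ∀ (S : Set X) (γ : Ordinal.{0}), IsOpen[b n] S → (∀ x ∈ S, γ < r n x ∧ r n x ≤ γ + l) →
    ∀ x ∈ S, ∀ m, n ≤ m → m < N → LabelsAt (τ m) Ψ m S (fun y => f (r n y - γ)) x

/-- The world `w` is the label of the endpoint of a good labelling of some interval `(0, l]`,
`l < ε₀`, whose other labels look like `n`-successors of `w` or worlds in its `n`-cluster. -/
def Realizable (n : ℕ) (w : GLPWorld) : Prop :=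
  ∃ (l : Ordinal.{0}) (f : Ordinal.{0} → GLPWorld), 0 < l ∧ l < ε₀ ∧
    GoodLabelling b τ r Ψ N n l f ∧ f l = w ∧ ∀ ξ, 0 < ξ → ξ ≤ l →
      (∀ m < n, ∀ φ, box m φ ∈ w.1 ↔ box m φ ∈ (f ξ).1) ∧
      (∀ φ, box n φ ∈ w.1 → box n φ ∈ (f ξ).1) ∧
      (ξ < l → ∀ φ, box n φ ∈ w.1 → φ ∈ (f ξ).1)

variable {b τ r Ψ N}

-- The preimages of `(γ, γ + l]` and of the part beyond `γ + l` are both open, so the two labellings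
-- do not interact.
open Classical in
theorem GoodLabelling.concat (ht : RankTower b τ r) {n : ℕ} {l l' : Ordinal.{0}}
    {f g : Ordinal.{0} → GLPWorld} (hf : GoodLabelling b τ r Ψ N n l f)
    (hg : GoodLabelling b τ r Ψ N n l' g) :
    GoodLabelling b τ r Ψ N n (l + l') fun ξ => if ξ ≤ l then f ξ else g (ξ - l) := by
  intro S γ hS hSγ x hx m hnm hmN
  let _ := b n
  by_cases hxl : r n x ≤ γ + l
  · have hS' : IsOpen[b n] (S ∩ {y | γ < r n y ∧ r n y ≤ γ + l}) :=
      IsOpen.inter hS ((ht.dmap n).isOpen_Ioc _ _)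
    have hxS' : x ∈ S ∩ {y | γ < r n y ∧ r n y ≤ γ + l} := ⟨hx, (hSγ x hx).1, hxl⟩
    refine (hf _ γ hS' (fun y hy => hy.2) x hxS' m hnm hmN).of_isOpen (ht.le_of_le hnm _ hS')
      Set.inter_subset_left hxS' fun y hy => ?_
    exact if_pos (sub_le.2 hy.2.2)
  · rw [not_le] at hxl
    have hS' : IsOpen[b n] (S ∩ {y | γ + l < r n y}) :=
      IsOpen.inter hS ((ht.dmap n).isOpen_gt _)
    have hxS' : x ∈ S ∩ {y | γ + l < r n y} := ⟨hx, hxl⟩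
    refine (hg _ (γ + l) hS' (fun y hy => ⟨hy.2, ?_⟩) x hxS' m hnm hmN).of_isOpen
      (ht.le_of_le hnm _ hS') Set.inter_subset_left hxS' fun y hy => ?_
    · rw [add_assoc]
      exact (hSγ y hy.1).2
    · have : ¬ r n y - γ ≤ l := fun h => (sub_le.1 h).not_gt hy.2
      simp only [this, if_false, sub_sub]

/-- On an interval of length one all points have the same value of `r n`, hence are isolated, and
every box holds vacuously. -/
theorem realizable_of_forall_box_mem (ht : RankTower b τ r) {n : ℕ} {w : GLPWorld}
    (hw : ∀ m, n ≤ m → m < N → ∀ ψ ∈ Ψ, box m ψ ∈ w.1) : Realizable b τ r Ψ N n w := by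
  refine ⟨1, fun _ => w, zero_lt_one, ?_, ?_, rfl, fun ξ h0 h1 =>
    ⟨fun _ _ _ => Iff.rfl, fun _ h => h, fun hlt => ?_⟩⟩
  · have := omega0_opow_lt_epsilon_zero (epsilon_pos 0)
    rwa [opow_zero] at this
  · intro S γ hS hSγ x hx m hnm hmN ψ hψ
    let _ := b n
    refine ⟨fun _ => ?_, fun _ => hw m hnm hmN ψ hψ⟩
    obtain ⟨U, hU, hxU, hdisc⟩ := (ht.dmap n).discrete x
    refine ⟨S ∩ U, ht.le_of_le hnm _ (IsOpen.inter hS hU), ⟨hx, hxU⟩, Set.inter_subset_left,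
      fun y hy hne => absurd (hdisc y hy.2 ?_) hne⟩
    have key : ∀ z ∈ S, r n z = γ + 1 := fun z hz =>
      le_antisymm (hSγ z hz).2 (add_one_le_iff.2 (hSγ z hz).1)
    rw [key x hx, key y hy.1]
  · exact absurd (Order.lt_one_iff.1 hlt) h0.ne'

open Classical in
/-- Successors of `w` refuting given formulas can be put side by side in one interval. -/
theorem exists_goodLabelling_successors (ht : RankTower b τ r) {n : ℕ} {w : GLPWorld}
    (B : Finset ModalFormula)
    (hB : ∀ ψ ∈ B, ∃ v, CanonicalRel n w v ∧ ψ ∉ v.1 ∧ Realizable b τ r Ψ N n v) :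
    ∃ (k : Ordinal.{0}) (h : Ordinal.{0} → GLPWorld), k < ε₀ ∧ GoodLabelling b τ r Ψ N n k h ∧
      (∀ ξ, 0 < ξ → ξ ≤ k → CanonicalRel n w (h ξ)) ∧
      ∀ ψ ∈ B, ∃ ξ, 0 < ξ ∧ ξ ≤ k ∧ ψ ∉ (h ξ).1 := by
  induction B using Finset.induction_on with
  | empty =>
    refine ⟨0, fun _ => w, epsilon_pos 0, fun S γ _ hS x hx => ?_, fun ξ h0 h1 => ?_, by simp⟩
    · have := hS x hx
      rw [add_zero] at this
      exact absurd this.1 this.2.not_gt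
    · exact absurd h0 h1.not_gt
  | insert ψ B _ ih =>
    obtain ⟨k, h, hk, hgood, hrel, href⟩ := ih fun χ hχ => hB χ (Finset.mem_insert_of_mem hχ)
    obtain ⟨v, hwv, hψv, l, f, hl0, hl, hf, hfl, hfrel⟩ := hB ψ (Finset.mem_insert_self _ _)
    refine ⟨k + l, _, add_lt_epsilon_zero hk hl, hgood.concat ht hf, fun ξ h0 h1 => ?_,
      fun χ hχ => ?_⟩
    · by_cases hξ : ξ ≤ k
      · simp only [hξ, if_true]
        exact hrel ξ h0 hξ
      · simp only [hξ, if_false]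
        have h0' : 0 < ξ - k := pos_iff_ne_zero.2 (Ordinal.sub_ne_zero_iff_lt.2 (not_le.1 hξ))
        have h1' : ξ - k ≤ l := sub_le.2 h1
        obtain ⟨hm, hbox, hmem⟩ := hfrel _ h0' h1'
        refine ⟨fun φ hφ => ?_, fun φ hφ => hbox φ (hwv.box_mem φ hφ), fun m hmn φ =>
          (hwv.box_mem_iff m hmn φ).trans (hm m hmn φ)⟩
        rcases h1'.lt_or_eq with hlt | heq
        · exact hmem hlt φ (hwv.box_mem φ hφ)
        · rw [heq, hfl]
          exact hwv.mem φ hφ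
    · rcases Finset.mem_insert.1 hχ with rfl | hχ
      · refine ⟨k + l, hl0.trans_le le_add_self, le_rfl, ?_⟩
        have : ¬ k + l ≤ k := not_le.2 (lt_add_of_pos_right k hl0)
        simp only [this, if_false, add_sub_cancel, hfl]
        exact hψv
      · obtain ⟨ξ, h0, h1, hξ⟩ := href χ hχ
        refine ⟨ξ, h0, h1.trans le_self_add, ?_⟩
        simp only [h1, if_true]
        exact hξ

open Classical in
/-- Blocks of length `k` labelled by `h`, accumulating at the points with end-logarithm above
`log ω k`, which are labelled by `g` according to their end-logarithm. -/
noncomputable def blockLabelling (k : Ordinal.{0}) (g h : Ordinal.{0} → GLPWorld)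
    (ξ : Ordinal.{0}) : GLPWorld :=
  if log ω k < endLog ξ then g (endLog ξ - log ω k) else h (blockPos k ξ)

theorem blockLabelling_mul_add {k q η : Ordinal.{0}} (g h : Ordinal.{0} → GLPWorld)
    (h0 : 0 < η) (h1 : η ≤ k) : blockLabelling k g h (k * q + η) = h η := by
  rw [blockLabelling, if_neg (endLog_mul_add_le h0 h1).not_gt, blockPos_mul_add h0 h1]

/-- The endpoint `ω ^ (a + l)` has end-logarithm `a + l`, so it receives the label `g l = w`. The
other labels are `n`-successors of `w` from `h`, or labels of `g`, which have the same
`[n]`-formulas as `w` and, off the endpoint, satisfy their contents because `[n]φ` implies `[n +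
1]φ`. -/
theorem Realizable.of_succ (ht : RankTower b τ r) {n : ℕ} {w : GLPWorld}
    (hw : Realizable b τ r Ψ N (n + 1) w) {k : Ordinal.{0}} {h : Ordinal.{0} → GLPWorld}
    (hk0 : k ≠ 0) (hk : k < ε₀) (hgood : GoodLabelling b τ r Ψ N n k h)
    (hrel : ∀ ξ, 0 < ξ → ξ ≤ k → CanonicalRel n w (h ξ))
    (href : ∀ ψ ∈ Ψ, box n ψ ∉ w.1 → ∃ ξ, 0 < ξ ∧ ξ ≤ k ∧ ψ ∉ (h ξ).1) :
    Realizable b τ r Ψ N n w := by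
  obtain ⟨l, g, hl0, hl, hg, hgl, hgrel⟩ := hw
  set a := log ω k with ha
  have hendLog_le : ∀ ξ, 0 < ξ → ξ ≤ ω ^ (a + l) → endLog ξ ≤ a + l := fun ξ h0 h1 =>
    (opow_le_opow_iff_right one_lt_omega0).1 ((omega0_opow_endLog_le h0.ne').trans h1)
  have hhigh : ∀ ξ, a < endLog ξ → blockLabelling k g h ξ = g (endLog ξ - a) := fun ξ hξ =>
    if_pos hξ
  have hinv : ∀ ξ, 0 < ξ → ξ ≤ ω ^ (a + l) →
      (∀ m < n, ∀ φ, box m φ ∈ w.1 ↔ box m φ ∈ (blockLabelling k g h ξ).1) ∧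
      (∀ φ, box n φ ∈ w.1 → box n φ ∈ (blockLabelling k g h ξ).1) ∧
      (ξ < ω ^ (a + l) → ∀ φ, box n φ ∈ w.1 → φ ∈ (blockLabelling k g h ξ).1) := by
    intro ξ h0 h1
    by_cases hξ : a < endLog ξ
    · rw [hhigh ξ hξ]
      obtain ⟨hm, -, hmem⟩ := hgrel (endLog ξ - a)
        (pos_iff_ne_zero.2 (Ordinal.sub_ne_zero_iff_lt.2 hξ)) (sub_le.2 (hendLog_le ξ h0 h1))
      refine ⟨fun m hmn => hm m (hmn.trans n.lt_succ_self), fun φ => (hm n n.lt_succ_self φ).1,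
        fun hlt φ hφ => hmem ?_ φ (w.2.box_of_lt n.lt_succ_self hφ)⟩
      exact sub_lt_of_lt_add (endLog_lt h0.ne' hlt) hl0
    · obtain ⟨q, η, hη0, hηk, rfl⟩ := exists_mul_add_of_endLog_le hk0 h0.ne' (not_lt.1 hξ)
      rw [blockLabelling_mul_add g h hη0 hηk]
      have := hrel η hη0 hηk
      exact ⟨this.box_mem_iff, this.box_mem, fun _ => this.mem⟩
  have haε : a < ε₀ := (log_le_self ω k).trans_lt hk
  refine ⟨ω ^ (a + l), blockLabelling k g h, opow_pos _ omega0_pos,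
    omega0_opow_lt_epsilon_zero (add_lt_epsilon_zero haε hl), ?_, ?_, hinv⟩
  swap
  · have hal : a < a + l := lt_add_of_pos_right a hl0
    rw [hhigh _ (by rwa [endLog_omega0_opow]), endLog_omega0_opow, add_sub_cancel, hgl]
  intro S γ hS hSγ x hx m hnm hmN
  have hpos : ∀ y ∈ S, 0 < r n y - γ := fun y hy =>
    pos_iff_ne_zero.2 (Ordinal.sub_ne_zero_iff_lt.2 (hSγ y hy).1)
  have hle : ∀ y ∈ S, r n y - γ ≤ ω ^ (a + l) := fun y hy => sub_le.2 (hSγ y hy).2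
  have hadd : ∀ y ∈ S, γ + (r n y - γ) = r n y := fun y hy =>
    Ordinal.add_sub_cancel_of_le (hSγ y hy).1.le
  have hrank : ∀ y ∈ S, r (n + 1) y = endLog (r n y - γ) := fun y hy => by
    rw [ht.rank_eq, ← endLog_add γ (hpos y hy).ne', hadd y hy]
  by_cases hxa : a < endLog (r n x - γ)
  · rcases hnm.lt_or_eq with hlt | rfl
    · let _ := b (n + 1)
      have hS' : IsOpen[b (n + 1)] (S ∩ {y | a < r (n + 1) y}) :=
        IsOpen.inter (((ht.succ_le n).trans (ht.le n)) _ hS) ((ht.dmap (n + 1)).isOpen_gt a)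
      have hxS' : x ∈ S ∩ {y | a < r (n + 1) y} := ⟨hx, by rwa [← hrank x hx] at hxa⟩
      refine (hg _ a hS' (fun y hy => ⟨hy.2, ?_⟩) x hxS' m hlt hmN).of_isOpen
        (ht.le_of_le hlt _ hS') Set.inter_subset_left hxS' fun y hy => ?_
      · rw [hrank y hy.1]
        exact hendLog_le _ (hpos y hy.1) (hle y hy.1)
      · have hy2 : a < r (n + 1) y := hy.2
        rw [hrank y hy.1] at hy2
        simp only [hhigh _ hy2, hrank y hy.1]
    · intro ψ hψ
      have hFx : box n ψ ∈ (blockLabelling k g h (r n x - γ)).1 ↔ box n ψ ∈ w.1 := by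
        rw [hhigh _ hxa]
        exact ((hgrel _ (pos_iff_ne_zero.2 (Ordinal.sub_ne_zero_iff_lt.2 hxa))
          (sub_le.2 (hendLog_le _ (hpos x hx) (hle x hx)))).1 n n.lt_succ_self ψ).symm
      simp only [hFx]
      constructor
      · intro hwψ
        obtain ⟨U, hU, hxU, hUS, hUlt⟩ := (ht.rank n).exists_isOpen_subset (ht.le n _ hS) hx
        refine ⟨U, hU, hxU, hUS, fun y hyU hne => ?_⟩
        have hyS := hUS hyU
        -- `y` is not at the endpoint: its rank would then be the maximal value `a + l`, yet it is
        -- below the rank of `x`.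
        refine (hinv _ (hpos y hyS) (hle y hyS)).2.2 (lt_of_le_of_ne (hle y hyS) fun e => ?_) ψ hwψ
        have hlt := hUlt y hyU hne
        rw [hrank y hyS, e, endLog_omega0_opow, hrank x hx] at hlt
        exact hlt.not_ge (hendLog_le _ (hpos x hx) (hle x hx))
      · rintro ⟨U, hU, hxU, hUS, hUψ⟩
        by_contra hwψ
        obtain ⟨η, hη0, hηk, hηψ⟩ := href ψ hψ hwψ
        have hxa' : a < r (n + 1) x := by rwa [hrank x hx]
        -- Rank `a + 1` is not a limit, so near `y₁` the set `U` contains a `b n`-neighborhood. As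
        -- `r n y₁ - γ = k * q` with `q` a limit, openness of `r n` puts a point at any prescribed
        -- place of some block below into `U`.
        obtain ⟨y₁, hy₁U, hy₁⟩ := (ht.rank n).exists_rank_eq hU hxU (succ_le_of_lt hxa')
        obtain ⟨V, hV, hy₁V, hVU⟩ := ht.nonlimit n U hU y₁ hy₁U
          (by rw [hy₁]; exact not_isSuccLimit_succ a)
        have hy₁S := hUS hy₁U
        rw [hrank y₁ hy₁S] at hy₁
        obtain ⟨q, hq, hy₁q⟩ := exists_mul_limit_of_log_lt_endLog hk0 (hpos y₁ hy₁S).ne'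
          (hy₁ ▸ lt_succ a)
        have hry₁ : r n y₁ = γ + k * q := by rw [← hy₁q, hadd y₁ hy₁S]
        have hkq : k * q ≠ 0 := hy₁q ▸ (hpos y₁ hy₁S).ne'
        obtain ⟨δ, hδ, hop⟩ := (ht.dmap n).open_map y₁ V hV hy₁V
          ((zero_le.trans_lt (hSγ y₁ hy₁S).1).ne')
        rw [hry₁] at hδ hop
        obtain ⟨d, hd, hδd⟩ := (lt_add_iff hkq).1 hδ
        obtain ⟨q', hq', hdq'⟩ := (lt_mul_iff_of_isSuccLimit hq).1 hd
        obtain ⟨y, hyV, hy⟩ := hop (γ + (k * q' + η))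
          (hδd.trans_lt (by simpa using hdq'.trans_le le_self_add))
          (by
            have h1 : k * q' + η ≤ k * q' + k := by simpa using hηk
            rw [← mul_succ] at h1
            exact add_le_add_right (h1.trans (mul_le_mul_right (succ_le_of_lt hq') k)) γ)
        have hyU := hVU hyV
        have hyγ : r n y - γ = k * q' + η := by rw [hy, add_sub_cancel]
        refine hηψ ?_
        have hne : y ≠ x := by
          rintro rfl
          rw [hyγ] at hxa
          exact hxa.not_ge (endLog_mul_add_le hη0 hηk)
        have := hUψ y hyU hne
        rwa [hyγ, blockLabelling_mul_add g h hη0 hηk] at this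
  · obtain ⟨q, η, hη0, hηk, hxq⟩ :=
      exists_mul_add_of_endLog_le hk0 (hpos x hx).ne' (not_lt.1 hxa)
    -- A point inside a block has the preimage of that block as an open neighborhood, where the
    -- labelling is a translate of `h`.
    let _ := b n
    have hS' : IsOpen[b n] (S ∩ {y | γ + k * q < r n y ∧ r n y ≤ γ + k * q + k}) :=
      IsOpen.inter hS ((ht.dmap n).isOpen_Ioc _ _)
    have hxS' : x ∈ S ∩ {y | γ + k * q < r n y ∧ r n y ≤ γ + k * q + k} := by
      refine ⟨hx, ?_⟩
      have : r n x = γ + k * q + η := by rw [← hadd x hx, hxq, add_assoc]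
      rw [Set.mem_ofPred_eq, this]
      exact ⟨lt_add_of_pos_right _ hη0, by simpa using hηk⟩
    refine (hgood _ (γ + k * q) hS' (fun y hy => hy.2) x hxS' m hnm hmN).of_isOpen
      (ht.le_of_le hnm _ hS') Set.inter_subset_left hxS' fun y hy => ?_
    obtain ⟨η', hη'⟩ := exists_add_of_le hy.2.1.le
    have hη'0 : 0 < η' := by
      have := hy.2.1
      rw [hη'] at this
      simpa using this
    have hη'k : η' ≤ k := by
      have := hy.2.2
      rw [hη'] at this
      simpa using this
    simp only [hη', add_sub_cancel]
    rw [add_assoc, add_sub_cancel, blockLabelling_mul_add g h hη'0 hη'k]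

/-- Downward induction on `n` from the vacuous case `N`, and for fixed `n` induction on the number
of `ψ ∈ Ψ` with `[n]ψ` false at `w`. -/
theorem realizable_of_le (ht : RankTower b τ r) {n : ℕ} (hn : n ≤ N) (w : GLPWorld) :
    Realizable b τ r Ψ N n w := by
  classical
  induction hn using Nat.decreasingInduction generalizing w with
  | self => exact realizable_of_forall_box_mem ht fun m h1 h2 => absurd h2 h1.not_gt
  | of_succ n hn ih =>
    induction hc : (Ψ.filter fun ψ => box n ψ ∉ w.1).card using Nat.strong_induction_on
      generalizing w with
    | h c ihc =>
      by_cases hall : ∀ ψ ∈ Ψ, box n ψ ∈ w.1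
      · exact realizable_of_forall_box_mem ht fun m hnm _ ψ hψ => w.2.box_of_le hnm (hall ψ hψ)
      push Not at hall
      obtain ⟨ψ₀, hψ₀, hψ₀w⟩ := hall
      obtain ⟨k, h, hk, hgood, hrel, href⟩ := exists_goodLabelling_successors (w := w) ht
        (Ψ.filter fun ψ => box n ψ ∉ w.1) (by
          intro ψ hψ
          rw [Finset.mem_filter] at hψ
          obtain ⟨v, hv, hψv, hψv'⟩ := exists_canonicalRel hψ.2
          refine ⟨v, hv, hψv', ihc _ ?_ v rfl⟩
          rw [← hc]
          refine Finset.card_lt_card ⟨fun χ hχ => ?_, fun hsub => ?_⟩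
          · rw [Finset.mem_filter] at hχ ⊢
            exact ⟨hχ.1, fun hn => hχ.2 (hv.box_mem χ hn)⟩
          · exact (Finset.mem_filter.1 (hsub (Finset.mem_filter.2 hψ))).2 hψv)
      have href' : ∀ ψ ∈ Ψ, box n ψ ∉ w.1 → ∃ ξ, 0 < ξ ∧ ξ ≤ k ∧ ψ ∉ (h ξ).1 := fun ψ h1 h2 =>
        href ψ (Finset.mem_filter.2 ⟨h1, h2⟩)
      obtain ⟨ξ, h0, h1, -⟩ := href' ψ₀ hψ₀ hψ₀w
      exact (ih w).of_succ ht (h0.trans_le h1).ne' hk hgood hrel href'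

end Labelling

/-! ### Soundness, the truth lemma and completeness. -/

section TopologicalSemantics

open Order Ordinal ModalFormula

variable {X : Type} {τ : ℕ → TopologicalSpace X} {v : ℕ → Set X}

theorem mem_value_imp (δ : ℕ → Set X → Set X) (φ ψ : ModalFormula) (x : X) :
    x ∈ (imp φ ψ).value δ v ↔ (x ∈ φ.value δ v → x ∈ ψ.value δ v) := by
  change x ∈ (φ.value δ v)ᶜ ∪ ψ.value δ v ↔ _
  simp only [Set.mem_union, Set.mem_compl_iff]
  tauto

theorem mem_value_box (n : ℕ) (φ : ModalFormula) (x : X) :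
    x ∈ (box n φ).value (fun n => derivOp (τ n)) v ↔
      ∃ U, IsOpen[τ n] U ∧ x ∈ U ∧ ∀ y ∈ U, y ≠ x → y ∈ φ.value (fun n => derivOp (τ n)) v := by
  change x ∉ derivOp (τ n) (φ.value _ v)ᶜ ↔ _
  rw [mem_derivOp_iff]
  push Not
  refine exists_congr fun U => and_congr_right fun _ => and_congr_right fun _ => ?_
  refine forall₂_congr fun y _ => ?_
  rw [Set.mem_compl_iff]
  tauto

theorem value_dia (n : ℕ) (φ : ModalFormula) :
    (dia n φ).value (fun n => derivOp (τ n)) v =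
      derivOp (τ n) (φ.value (fun n => derivOp (τ n)) v) := by
  simp [dia, neg, ModalFormula.value]

/-- Soundness of GLP for topologies of which each is scattered, finer than the preceding ones,
and contains their derived sets. -/
theorem GLP_subset_topLog {ρ : ℕ → X → Ordinal.{0}} (hτ : Antitone τ)
    (hρ : ∀ n, IsRank (τ n) (ρ n))
    (hd : ∀ m n, m < n → ∀ A, IsOpen[τ n] (derivOp (τ m) A)) : GLP ⊆ topLog τ := by
  intro φ hφ v
  refine Set.eq_univ_of_forall ?_
  induction hφ with
  | taut h => exact fun x => h (fun ψ => x ∈ ψ.value _ v) id fun ψ χ => mem_value_imp _ _ _ _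
  | distr n φ ψ =>
    intro x
    let _ := τ n
    simp only [mem_value_imp, mem_value_box]
    rintro ⟨U, hU, hxU, h⟩ ⟨U', hU', hxU', h'⟩
    exact ⟨U ∩ U', IsOpen.inter hU hU', ⟨hxU, hxU'⟩, fun y hy hne =>
      h y hy.1 hne (h' y hy.2 hne)⟩
  | loeb n φ =>
    intro x
    rw [mem_value_imp, mem_value_box, mem_value_box]
    rintro ⟨U, hU, hxU, h⟩
    obtain ⟨V, hV, hxV, hVU, hlt⟩ := (hρ n).exists_isOpen_subset hU hxU
    refine ⟨V, hV, hxV, fun y hyV hne => ?_⟩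
    have hy := hlt y hyV hne
    clear hne
    induction hα : ρ n y using WellFoundedLT.induction generalizing y with
    | ind α ih =>
      refine (mem_value_imp _ _ _ _).1 (h y (hVU hyV) ?_) ((mem_value_box _ _ _).2 ?_)
      · rintro rfl
        exact lt_irrefl _ hy
      · obtain ⟨W, hW, hyW, hWV, hWlt⟩ := (hρ n).exists_isOpen_subset hV hyV
        exact ⟨W, hW, hyW, fun z hzW hne =>
          ih (ρ n z) (hα ▸ hWlt z hzW hne) z (hWV hzW) ((hWlt z hzW hne).trans hy) rfl⟩
  | mono hmn φ =>
    intro x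
    rw [mem_value_imp, mem_value_box, mem_value_box]
    rintro ⟨U, hU, h⟩
    exact ⟨U, hτ hmn.le _ hU, h⟩
  | @negIntro m n hmn φ =>
    intro x
    rw [mem_value_imp, mem_value_box, value_dia]
    exact fun hx => ⟨_, hd m n hmn _, hx, fun y hy _ => hy⟩
  | mp _ _ ih1 ih2 => exact fun x => (mem_value_imp _ _ _ _).1 (ih2 x) (ih1 x)
  | nec n _ ih =>
    intro x
    rw [mem_value_box]
    let _ := τ n
    exact ⟨Set.univ, isOpen_univ, trivial, fun y _ _ => ih y⟩

/-- All boxed subformulas `[m]ψ` satisfy `m < N` and `ψ ∈ Ψ`. -/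
def ModalFormula.BoxesIn (Ψ : Finset ModalFormula) (N : ℕ) : ModalFormula → Prop
  | var _ => True
  | bot => True
  | imp φ ψ => φ.BoxesIn Ψ N ∧ ψ.BoxesIn Ψ N
  | box n φ => n < N ∧ φ ∈ Ψ ∧ φ.BoxesIn Ψ N

theorem ModalFormula.BoxesIn.mono {Ψ Ψ' : Finset ModalFormula} {N N' : ℕ} (hΨ : Ψ ⊆ Ψ')
    (hN : N ≤ N') {φ : ModalFormula} (h : φ.BoxesIn Ψ N) : φ.BoxesIn Ψ' N' := by
  induction φ with
  | var _ => trivial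
  | bot => trivial
  | imp φ ψ ih1 ih2 => exact ⟨ih1 h.1, ih2 h.2⟩
  | box n φ ih => exact ⟨h.1.trans_le hN, hΨ h.2.1, ih h.2.2⟩

theorem ModalFormula.exists_boxesIn (φ : ModalFormula) : ∃ Ψ N, φ.BoxesIn Ψ N := by
  classical
  induction φ with
  | var _ => exact ⟨∅, 0, trivial⟩
  | bot => exact ⟨∅, 0, trivial⟩
  | imp φ ψ ih1 ih2 =>
    obtain ⟨Ψ, N, h⟩ := ih1
    obtain ⟨Ψ', N', h'⟩ := ih2
    exact ⟨Ψ ∪ Ψ', max N N', h.mono Finset.subset_union_left (le_max_left _ _),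
      h'.mono Finset.subset_union_right (le_max_right _ _)⟩
  | box n φ ih =>
    obtain ⟨Ψ, N, h⟩ := ih
    exact ⟨insert φ Ψ, max N (n + 1), n.lt_succ_self.trans_le (le_max_right _ _),
      Finset.mem_insert_self _ _, h.mono (Finset.subset_insert _ _) (le_max_left _ _)⟩

/-- The truth lemma for the valuation read off the labels. Labels outside `S` are harmless because
`S` is open in all topologies concerned. -/
theorem mem_value_iff_mem_label {Ψ : Finset ModalFormula} {N : ℕ} {S : Set X}
    {F : X → GLPWorld} (hS : ∀ m < N, IsOpen[τ m] S)
    (hF : ∀ x ∈ S, ∀ m < N, LabelsAt (τ m) Ψ m S F x) {φ : ModalFormula}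
    (hφ : φ.BoxesIn Ψ N) {x : X} (hx : x ∈ S) :
    x ∈ φ.value (fun n => derivOp (τ n)) (fun p => {y | var p ∈ (F y).1}) ↔ φ ∈ (F x).1 := by
  induction φ generalizing x with
  | var p => exact Iff.rfl
  | bot => exact ⟨False.elim, (F x).2.bot_notMem⟩
  | imp φ ψ ih1 ih2 => rw [mem_value_imp, (F x).2.imp_mem_iff, ih1 hφ.1 hx, ih2 hφ.2 hx]
  | box n φ ih =>
    rw [mem_value_box, hF x hx n hφ.1 φ hφ.2.1]
    let _ := τ n
    constructor
    · rintro ⟨U, hU, hxU, h⟩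
      exact ⟨U ∩ S, IsOpen.inter hU (hS n hφ.1), ⟨hxU, hx⟩, Set.inter_subset_right,
        fun y hy hne => (ih hφ.2.2 hy.2).1 (h y hy.1 hne)⟩
    · rintro ⟨U, hU, hxU, hUS, h⟩
      exact ⟨U, hU, hxU, fun y hy hne => (ih hφ.2.2 (hUS hy)).2 (h y hy hne)⟩

/-- Every ordinal lme-space on `ε₀` has the logic GLP. -/
theorem IsOrdinalLmeSpace.topLog_eq {τ : ℕ → TopologicalSpace (ε₀ : Ordinal.{0}).ToType}
    (h : IsOrdinalLmeSpace (ε₀ : Ordinal.{0}) τ) : topLog τ = GLP := by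
  have ht := IsLmeSpace.rankTower h (isOrdinalDMap_pos ε₀)
  refine Set.Subset.antisymm (fun φ hφ => ?_) (GLP_subset_topLog ht.antitone ht.rank
    fun m n hmn A => ht.le_of_le hmn _ (isOpen_plusTopology_derivOp _ A))
  by_contra hφ'
  obtain ⟨w, hw⟩ := exists_world_of_not_provable hφ'
  obtain ⟨Ψ, N, hΨ⟩ := φ.exists_boxesIn
  obtain ⟨l, f, hl0, hl, hf, hfl, -⟩ := realizable_of_le (Ψ := Ψ) ht N.zero_le w
  -- Since `l < ε₀`, the endpoint `l` is a point of the space; its label `w` omits `φ`.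
  obtain ⟨x, hx⟩ : ∃ x : (ε₀ : Ordinal.{0}).ToType, x.pos = l :=
    typein_surj _ (by rwa [type_toType])
  have hS := (isOrdinalDMap_pos ε₀).isOpen_Ioc 0 l
  have hxS : x ∈ {y : (ε₀ : Ordinal.{0}).ToType | 0 < y.pos ∧ y.pos ≤ l} :=
    ⟨hx ▸ hl0, hx.le⟩
  have key := mem_value_iff_mem_label (fun m _ => ht.le_of_le m.zero_le _ hS)
    (fun y hy m hm => hf _ 0 hS (fun z hz => ⟨hz.1, by rw [zero_add]; exact hz.2⟩) y hy m
      m.zero_le hm) hΨ hxS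
  rw [hφ] at key
  have hmem := key.1 trivial
  simp only [Function.iterate_zero, id, hx, Ordinal.sub_zero, hfl] at hmem
  exact hw hmem

end TopologicalSemantics

open scoped Ordinal in
theorem mainTheorem2 :
    ∃ τ : ℕ → TopologicalSpace (ε₀ : Ordinal.{0}).ToType,
      IsOrdinalLmeSpace (ε₀ : Ordinal.{0}) τ ∧ topLog τ = GLP := by
  obtain ⟨τ, hτ⟩ := exists_isLmeSpace (isOrdinalDMap_pos (ε₀ : Ordinal.{0})).isRank.isScattered
  exact ⟨τ, hτ, IsOrdinalLmeSpace.topLog_eq hτ⟩
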